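/- **Setting.** All Hilbert spaces are complex. Inner products, sesquilinear forms and duality products are linear in the first and antilinear in the second argument. $\mathcal X^*$ denotes the anti-dual of a Hilbert space $\mathcal X$ (continuous antilinear functionals), $\langle x',x\rangle_{\mathcal X^*,\mathcal X}=x'(x)$, $\langle x,x'\rangle_{\mathcal X,\mathcal X^*}=\overline{x'(x)}$, and $\mathcal R_{\mathcal X}:\mathcal X\to\mathcal X^*$, $x\mapsto\langle x,\cdot\rangle_{\mathcal X}$, is the Riesz isomorphism. $\mathbb C_+=\{s\in\mathbb C:\operatorname{Re}s>0\}$. Let $\mathcal X,\mathcal U$ be Hilbert spaces and let $h:\operatorname{dom}h\times\operatorname{dom}h\to\mathbb C$ be a sesquilinear form with dense domain $\operatorname{dom}h\subset\mathcal X$ which is positive ($h(x,x)>0$ for $x\neq0$) and closed ($\operatorname{dom}h$ is complete for the norm $(\|x\|_{\mathcal X}^2+h(x,x))^{1/2}$). The energetic space $\mathcal X_h$ is the completion of $\operatorname{dom}h$ for the norm $h(x,x)^{1/2}$. Let $H$ be the positive self-adjoint operator in $\mathcal X$ associated with $h$ (so $\operatorname{dom}H^{1/2}=\operatorname{dom}h$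 and $h(x,y)=\langle H^{1/2}x,H^{1/2}y\rangle_{\mathcal X}$; equivalently, $x\in\operatorname{dom}H$, $Hx=f$ iff $x\in\operatorname{dom}h$ and $h(x,y)=\langle f,y\rangle_{\mathcal X}$ for all $y\in\operatorname{dom}h$), and let $\widetilde H\in L(\mathcal X_h,\mathcal X_h^*)$ be its energetic extension, i.e. the unique bounded operator with $\langle\widetilde Hx,y\rangle_{\mathcal X_h^*,\mathcal X_h}=\langle Hx,y\rangle_{\mathcal X}$ for $x\in\operatorname{dom}H$, $y\in\operatorname{dom}h$. The Hamiltonian $\mathcal H:\mathcal X_h\to\mathbb R$ is the continuous extension of $x\mapsto\frac12h(x,x)$, i.e. $\mathcal H(x)=\frac12\|x\|_{\mathcal X_h}^2$. Let $M=\begin{bmatrix}F\&G\\K\&L\end{bmatrix}:\mathcal X_h^*\times\mathcal U\supset\operatorname{dom}M\to\mathcal X_h\times\mathcal U^*$ be a dissipation node on $(\mathcal X_h,\mathcal U)$, i.e. a linear operator such that (i) $M$ is closed, and dissipative: $\operatorname{Re}\langle Mz,z\rangle_{\mathcal X_h\times\mathcal U^*,\mathcal X_h^*\times\mathcal U}\le0$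 for all $z\in\operatorname{dom}M$; (ii) $F\&G=P_{\mathcal X_h}M$, with domain $\operatorname{dom}M$, is closed; (iii) for every $u\in\mathcal U$ there is $x'\in\mathcal X_h^*$ with $(x',u)\in\operatorname{dom}M$; (iv) for the main operator $F$, $Fx'=P_{\mathcal X_h}M(x',0)$ with $\operatorname{dom}F=\{x':(x',0)\in\operatorname{dom}M\}$, the operator $\lambda\mathcal R_{\mathcal X_h}^{-1}-F$ has dense range for some $\lambda\in\mathbb C_+$. Let $$S=\begin{bmatrix}I_{\mathcal X_h}&0\\0&-I_{\mathcal U^*}\end{bmatrix}M\begin{bmatrix}\widetilde H&0\\0&I_{\mathcal U}\end{bmatrix},\qquad\operatorname{dom}S=\{(x,u)\in\mathcal X_h\times\mathcal U:(\widetilde Hx,u)\in\operatorname{dom}M\},$$ and write $A\&B$, $C\&D$ for the two rows of $S$, and $A$ for its main operator, $Ax=A\&B(x,0)$ with $\operatorname{dom}A=\{x:(x,0)\in\operatorname{dom}S\}$. A system node on $(\mathcal Y,\mathcal X,\mathcal U)$ is a closed operator $S:\mathcal X\times\mathcal U\supset\operatorname{dom}S\to\mathcal X\times\mathcal Y$ whose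 upper row is closed, such that for every $u\in\mathcal U$ some $(x,u)\in\operatorname{dom}S$, and whose main operator $A$ is densely defined, has nonempty resolvent set $\rho(A)$ and generates a strongly continuous semigroup. Its transfer function is $\mathcal G:\rho(A)\to L(\mathcal U,\mathcal Y)$, $\mathcal G(s)=C\&D\begin{bmatrix}(sI-A_{-1})^{-1}B\\I\end{bmatrix}$, where $\mathcal X_{-1}$ is the completion of $\mathcal X$ for $\|(\alpha I-A)^{-1}\cdot\|$ with some (any) $\alpha\in\rho(A)$ and $[A_{-1}\ B]:\mathcal X\times\mathcal U\to\mathcal X_{-1}$ is the bounded extension of $A\&B$. A classical trajectory on $[0,T]$ is a triple $(y,x,u)\in C([0,T];\mathcal Y)\times C^1([0,T];\mathcal X)\times C([0,T];\mathcal U)$ with $(x(t),u(t))\in\operatorname{dom}S$ and $(\dot x(t),y(t))=S(x(t),u(t))$ for all $t\in[0,T]$; a generalized trajectory is a limit of classical ones in $L^2([0,T];\mathcal Y)\times C([0,T];\mathcal X)\times L^2([0,T];\mathcal U)$. **Theorem (Port-Hamiltonian system node).** The following holds. (a) $S$ is a system node on $(\mathcal U^*,\mathcal X_h,\mathcal U)$.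 (b) The main operator of $S$ is $A=F\widetilde H$, and it generates a strongly continuous contraction semigroup on $\mathcal X_h$. (c) $\mathbb C_+\subset\rho(A)$, the transfer function $\mathcal G:\rho(A)\to L(\mathcal U,\mathcal U^*)$ of $S$ is well defined, and $\operatorname{Re}\langle\mathcal G(s)u,u\rangle_{\mathcal U^*,\mathcal U}\ge0$ for all $s\in\mathbb C_+$, $u\in\mathcal U$. (d) Let $T>0$. Every classical trajectory $(y,x,u)$ on $[0,T]$ satisfies, for all $t\in[0,T]$, $$\mathcal H(x(t))-\mathcal H(x(0))=\operatorname{Re}\int_0^t\left\langle M\begin{pmatrix}\widetilde Hx(\tau)\\u(\tau)\end{pmatrix},\begin{pmatrix}\widetilde Hx(\tau)\\u(\tau)\end{pmatrix}\right\rangle d\tau+\operatorname{Re}\int_0^t\langle y(\tau),u(\tau)\rangle_{\mathcal U^*,\mathcal U}\,d\tau\le\operatorname{Re}\int_0^t\langle y(\tau),u(\tau)\rangle_{\mathcal U^*,\mathcal U}\,d\tau,$$ where the integrands are integrable. Every generalized trajectory $(y,x,u)$ on $[0,T]$ satisfies the dissipation inequality $$\mathcal H(x(t))-\mathcal H(x(0))\le\operatorname{Re}\int_0^t\langle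 y(\tau),u(\tau)\rangle_{\mathcal U^*,\mathcal U}\,d\tau\qquad\text{for all }t\in[0,T],$$ and the equality above holds for it when the integral containing $M$ is understood as a limit: for every sequence $(y_n,x_n,u_n)$ of classical trajectories on $[0,T]$ that converges to $(y,x,u)$ in $L^2([0,T];\mathcal U^*)\times C([0,T];\mathcal X_h)\times L^2([0,T];\mathcal U)$, $$\lim_{n\to\infty}\operatorname{Re}\int_0^t\left\langle M\begin{pmatrix}\widetilde Hx_n\\u_n\end{pmatrix},\begin{pmatrix}\widetilde Hx_n\\u_n\end{pmatrix}\right\rangle d\tau=\mathcal H(x(t))-\mathcal H(x(0))-\operatorname{Re}\int_0^t\langle y,u\rangle_{\mathcal U^*,\mathcal U}\,d\tau .$$ -/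

import Mathlib

open Filter Topology MeasureTheory Set
open scoped ComplexOrder InnerProductSpace

noncomputable section

/-! ### Anti-duals and unbounded operators -/

/-- The anti-dual: continuous antilinear functionals. The duality product of `x' : AntiDual E` and
`x : E` is `x' x`, which is linear in `x'` and antilinear in `x`. -/
abbrev AntiDual (E : Type*) [NormedAddCommGroup E] [InnerProductSpace ℂ E] : Type _ :=
  E →L⋆[ℂ] ℂ

/-- The Riesz map `x ↦ ⟨x, ·⟩` into the anti-dual. Mathlib's `inner` is antilinear in its first
argument, so that `⟨x, y⟩` (linear in `x`) is `inner ℂ y x`. -/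
def rieszMap (E : Type*) [NormedAddCommGroup E] [InnerProductSpace ℂ E] :
    E →L[ℂ] AntiDual E :=
  (innerSL ℂ (E := E)).flip

theorem rieszMap_apply {E : Type*} [NormedAddCommGroup E] [InnerProductSpace ℂ E] (x y : E) :
    rieszMap E x y = inner ℂ y x := rfl

theorem rieszMap_bijective (E : Type*) [NormedAddCommGroup E] [InnerProductSpace ℂ E]
    [CompleteSpace E] : Function.Bijective (rieszMap E) := by
  constructor
  · intro x y hxy
    refine ext_inner_left ℂ fun v => ?_
    rw [← rieszMap_apply, ← rieszMap_apply, hxy]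
  · intro f
    let g : StrongDual ℂ E := (starL ℂ : ℂ ≃L⋆[ℂ] ℂ).toContinuousLinearMap.comp f
    refine ⟨(InnerProductSpace.toDual ℂ E).symm g, ?_⟩
    ext y
    rw [rieszMap_apply, ← inner_conj_symm, InnerProductSpace.toDual_symm_apply]
    simp [g]

/-- The Riesz isomorphism of a Hilbert space onto its anti-dual. -/
def rieszEquiv (E : Type*) [NormedAddCommGroup E] [InnerProductSpace ℂ E] [CompleteSpace E] :
    E ≃ₗ[ℂ] AntiDual E :=
  LinearEquiv.ofBijective (rieszMap E).toLinearMap (rieszMap_bijective E)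

section Operators

variable {E F G : Type*} [AddCommGroup E] [Module ℂ E] [AddCommGroup F] [Module ℂ F]
  [AddCommGroup G] [Module ℂ G]

/-- The composition `f ∘ T` of an unbounded operator `f` with an everywhere defined `T`, on the
natural domain `{x | T x ∈ dom f}`. -/
def precompPMap (f : F →ₗ.[ℂ] G) (T : E →ₗ[ℂ] F) : E →ₗ.[ℂ] G where
  domain := f.domain.comap T
  toFun := f.toFun.comp (T.restrict fun _ hx => hx)

/-- The value of an unbounded operator, set to `0` off its domain. -/
def LinearPMap.evalZero (f : E →ₗ.[ℂ] F) (x : E) : F :=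
  open Classical in if hx : x ∈ f.domain then f ⟨x, hx⟩ else 0

end Operators

section Blocks

variable {E X U Y : Type*} [AddCommGroup E] [Module ℂ E] [AddCommGroup X] [Module ℂ X]
  [AddCommGroup U] [Module ℂ U] [AddCommGroup Y] [Module ℂ Y]

/-- The upper row `P_X S` (that is `A&B`) of a block operator. -/
def upperRow (S : (E × U) →ₗ.[ℂ] (X × Y)) : (E × U) →ₗ.[ℂ] X :=
  (LinearMap.fst ℂ X Y).compPMap S

/-- The lower row `P_Y S` (that is `C&D`) of a block operator. -/
def lowerRow (S : (E × U) →ₗ.[ℂ] (X × Y)) : (E × U) →ₗ.[ℂ] Y :=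
  (LinearMap.snd ℂ X Y).compPMap S

/-- The main operator `x ↦ P_X S (x, 0)` with domain `{x | (x, 0) ∈ dom S}`. -/
def mainOperator (S : (E × U) →ₗ.[ℂ] (X × Y)) : E →ₗ.[ℂ] X :=
  precompPMap (upperRow S) (LinearMap.inl ℂ E U)

end Blocks

/-! ### Resolvent set, strongly continuous semigroups, system nodes -/

section Semigroups

variable {X : Type*} [NormedAddCommGroup X] [NormedSpace ℂ X]

/-- `R` is a bounded two-sided inverse of `s I - A`. -/
structure IsResolventAt (A : X →ₗ.[ℂ] X) (s : ℂ) (R : X →L[ℂ] X) : Prop where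
  left_inv : ∀ x : A.domain, R (s • (x : X) - A x) = x
  right_inv : ∀ z : X, ∃ hz : R z ∈ A.domain, s • R z - A ⟨R z, hz⟩ = z

/-- The resolvent set of an unbounded operator. -/
def resolventSetOf (A : X →ₗ.[ℂ] X) : Set ℂ :=
  {s | ∃ R : X →L[ℂ] X, IsResolventAt A s R}

/-- Strongly continuous semigroups of bounded operators. -/
structure IsC0Semigroup (T : ℝ → X →L[ℂ] X) : Prop where
  zero : T 0 = 1
  add : ∀ s t : ℝ, 0 ≤ s → 0 ≤ t → T (s + t) = T s * T t
  strong_cont : ∀ x : X, Tendsto (fun t => T t x) (𝓝[>] 0) (𝓝 x)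

/-- `A` is the infinitesimal generator of `T`: `A x = lim_{t ↓ 0} (T t x - x) / t`, defined for
exactly those `x` for which the limit exists. -/
def IsGeneratorOf (A : X →ₗ.[ℂ] X) (T : ℝ → X →L[ℂ] X) : Prop :=
  ∀ x z : X, (x, z) ∈ A.graph ↔ Tendsto (fun t : ℝ => t⁻¹ • (T t x - x)) (𝓝[>] 0) (𝓝 z)

/-- `A` generates a strongly continuous semigroup. -/
def GeneratesC0Semigroup (A : X →ₗ.[ℂ] X) : Prop :=
  ∃ T : ℝ → X →L[ℂ] X, IsC0Semigroup T ∧ IsGeneratorOf A T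

/-- `A` generates a contractive strongly continuous semigroup. -/
def GeneratesContractionSemigroup (A : X →ₗ.[ℂ] X) : Prop :=
  ∃ T : ℝ → X →L[ℂ] X, IsC0Semigroup T ∧ IsGeneratorOf A T ∧ ∀ t : ℝ, 0 ≤ t → ‖T t‖ ≤ 1

end Semigroups

section Nodes

variable {X U Y : Type*} [NormedAddCommGroup X] [NormedSpace ℂ X]
  [NormedAddCommGroup U] [NormedSpace ℂ U] [NormedAddCommGroup Y] [NormedSpace ℂ Y]

/-- Operator nodes on `(Y, X, U)`. -/
structure IsOperatorNode (S : (X × U) →ₗ.[ℂ] (X × Y)) : Prop where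
  closed : S.IsClosed
  upperRow_closed : (upperRow S).IsClosed
  exists_state : ∀ u : U, ∃ x : X, (x, u) ∈ S.domain
  dense_domain : Dense ((mainOperator S).domain : Set X)
  resolventSet_nonempty : (resolventSetOf (mainOperator S)).Nonempty

/-- System nodes on `(Y, X, U)`. -/
structure IsSystemNode (S : (X × U) →ₗ.[ℂ] (X × Y)) : Prop extends IsOperatorNode S where
  generates : GeneratesC0Semigroup (mainOperator S)

end Nodes

/-! ### The extrapolation space and the transfer function -/

section Extrapolation

variable {X : Type*} [NormedAddCommGroup X] [NormedSpace ℂ X]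

/-- The resolvent `(α I - A)⁻¹` for `α ∈ ρ(A)`. -/
def resolventOf (A : X →ₗ.[ℂ] X) (α : resolventSetOf A) : X →L[ℂ] X :=
  Classical.choose α.2

theorem resolventOf_spec (A : X →ₗ.[ℂ] X) (α : resolventSetOf A) :
    IsResolventAt A α (resolventOf A α) :=
  Classical.choose_spec α.2

theorem resolventOf_injective (A : X →ₗ.[ℂ] X) (α : resolventSetOf A) :
    Function.Injective (resolventOf A α) := by
  intro x y hxy
  obtain ⟨hx, hx'⟩ := (resolventOf_spec A α).right_inv x
  obtain ⟨hy, hy'⟩ := (resolventOf_spec A α).right_inv y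
  rw [← hx', ← hy']
  simp only [hxy]

/-- A copy of `X`, to carry the norm `x ↦ ‖(α I - A)⁻¹ x‖`. -/
def PreExtrapolation (A : X →ₗ.[ℂ] X) (_ : resolventSetOf A) : Type _ := X

instance (A : X →ₗ.[ℂ] X) (α : resolventSetOf A) : AddCommGroup (PreExtrapolation A α) :=
  inferInstanceAs (AddCommGroup X)

instance (A : X →ₗ.[ℂ] X) (α : resolventSetOf A) : Module ℂ (PreExtrapolation A α) :=
  inferInstanceAs (Module ℂ X)

/-- The resolvent as a linear map on the copy of `X`. -/
def PreExtrapolation.resolvent (A : X →ₗ.[ℂ] X) (α : resolventSetOf A) :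
    PreExtrapolation A α →ₗ[ℂ] X :=
  (resolventOf A α).toLinearMap

instance (A : X →ₗ.[ℂ] X) (α : resolventSetOf A) :
    NormedAddCommGroup (PreExtrapolation A α) :=
  NormedAddCommGroup.induced (PreExtrapolation A α) X (PreExtrapolation.resolvent A α)
    (resolventOf_injective A α)

instance (A : X →ₗ.[ℂ] X) (α : resolventSetOf A) : NormedSpace ℂ (PreExtrapolation A α) :=
  NormedSpace.induced ℂ (PreExtrapolation A α) X (PreExtrapolation.resolvent A α)

/-- The extrapolation space `X_{-1}`: the completion of `X` for `x ↦ ‖(α I - A)⁻¹ x‖`. -/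
abbrev ExtrapolationSpace (A : X →ₗ.[ℂ] X) (α : resolventSetOf A) : Type _ :=
  UniformSpace.Completion (PreExtrapolation A α)

/-- The embedding of `X` into `X_{-1}`. -/
def toExtrapolation (A : X →ₗ.[ℂ] X) (α : resolventSetOf A) (x : X) : ExtrapolationSpace A α :=
  ((show PreExtrapolation A α from x : PreExtrapolation A α) : ExtrapolationSpace A α)

theorem norm_toExtrapolation (A : X →ₗ.[ℂ] X) (α : resolventSetOf A) (x : X) :
    ‖toExtrapolation A α x‖ = ‖resolventOf A α x‖ :=
  UniformSpace.Completion.norm_coe _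

end Extrapolation

section Transfer

variable {X U Y : Type*} [NormedAddCommGroup X] [NormedSpace ℂ X]
  [NormedAddCommGroup U] [NormedSpace ℂ U] [NormedAddCommGroup Y] [NormedSpace ℂ Y]

/-- `G : ρ(A) → L(U, Y)` is the transfer function `s ↦ C&D [(s I - A_{-1})⁻¹ B; I]` of the node `S`.
Here `[A_{-1} B] : X × U → X_{-1}` is the bounded extension of `A&B`, and
`x = (s I - A_{-1})⁻¹ B u` is expressed as `s x - A_{-1} x = B u` in `X_{-1}`. The space `X_{-1}`
is formed with an arbitrary `α ∈ ρ(A)`. -/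
def IsTransferFunction (S : (X × U) →ₗ.[ℂ] (X × Y))
    (G : resolventSetOf (mainOperator S) → U →L[ℂ] Y) : Prop :=
  ∀ α : resolventSetOf (mainOperator S),
    ∃ (A₁ : X →L[ℂ] ExtrapolationSpace (mainOperator S) α)
      (B : U →L[ℂ] ExtrapolationSpace (mainOperator S) α),
      (∀ z : (upperRow S).domain,
        A₁ (z : X × U).1 + B (z : X × U).2 =
          toExtrapolation (mainOperator S) α (upperRow S z)) ∧
      ∀ (s : resolventSetOf (mainOperator S)) (u : U),
        ∃ (x : X) (hx : (x, u) ∈ (lowerRow S).domain),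
          (s : ℂ) • toExtrapolation (mainOperator S) α x - A₁ x = B u ∧
          G s u = lowerRow S ⟨(x, u), hx⟩

end Transfer

/-! ### Classical and generalized trajectories -/

section Trajectories

variable {X U Y : Type*} [NormedAddCommGroup X] [NormedSpace ℂ X]
  [NormedAddCommGroup U] [NormedSpace ℂ U] [NormedAddCommGroup Y] [NormedSpace ℂ Y]

/-- Classical trajectories on `[0, T]` of `(x', y) = S (x, u)`. -/
structure IsClassicalTrajectory (S : (X × U) →ₗ.[ℂ] (X × Y)) (T : ℝ)
    (y : ℝ → Y) (x : ℝ → X) (u : ℝ → U) : Prop where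
  y_cont : ContinuousOn y (Icc 0 T)
  x_contDiff : ContDiffOn ℝ 1 x (Icc 0 T)
  u_cont : ContinuousOn u (Icc 0 T)
  equation : ∀ t ∈ Icc 0 T, ((x t, u t), (derivWithin x (Icc 0 T) t, y t)) ∈ S.graph

/-- Convergence in `L²([0, T]; Y) × C([0, T]; X) × L²([0, T]; U)`. -/
structure TrajectoryTendsto (T : ℝ) (yn : ℕ → ℝ → Y) (xn : ℕ → ℝ → X) (un : ℕ → ℝ → U)
    (y : ℝ → Y) (x : ℝ → X) (u : ℝ → U) : Prop where
  y_tendsto : Tendsto (fun n => eLpNorm (yn n - y) 2 (volume.restrict (Icc 0 T))) atTop (𝓝 0)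
  x_tendsto : TendstoUniformlyOn xn x atTop (Icc 0 T)
  u_tendsto : Tendsto (fun n => eLpNorm (un n - u) 2 (volume.restrict (Icc 0 T))) atTop (𝓝 0)

/-- Generalized trajectories on `[0, T]`: limits of classical trajectories in
`L²([0, T]; Y) × C([0, T]; X) × L²([0, T]; U)`. -/
structure IsGeneralizedTrajectory (S : (X × U) →ₗ.[ℂ] (X × Y)) (T : ℝ)
    (y : ℝ → Y) (x : ℝ → X) (u : ℝ → U) : Prop where
  y_memLp : MemLp y 2 (volume.restrict (Icc 0 T))
  x_cont : ContinuousOn x (Icc 0 T)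
  u_memLp : MemLp u 2 (volume.restrict (Icc 0 T))
  approx : ∃ (yn : ℕ → ℝ → Y) (xn : ℕ → ℝ → X) (un : ℕ → ℝ → U),
    (∀ n, IsClassicalTrajectory S T (yn n) (xn n) (un n)) ∧ TrajectoryTendsto T yn xn un y x u

end Trajectories

/-! ### Closed positive forms, the energetic space and the energetic extension -/

/-- Densely defined, closed, positive sesquilinear forms on `X`, linear in the first and antilinear
in the second argument. (`0 < z` for `z : ℂ` means that `z` is real and positive.)
Closedness is completeness of the domain for the norm `(‖x‖² + h(x, x))^(1/2)`. -/
structure ClosedPositiveForm (X : Type*) [NormedAddCommGroup X] [InnerProductSpace ℂ X] where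
  dom : Submodule ℂ X
  dense_dom : Dense (dom : Set X)
  form : dom →ₗ[ℂ] dom →ₗ⋆[ℂ] ℂ
  pos : ∀ x : dom, x ≠ 0 → 0 < form x x
  complete : ∀ v : ℕ → dom,
    (∀ ε : ℝ, 0 < ε → ∃ N, ∀ m ≥ N, ∀ n ≥ N,
      √(‖((v m - v n : dom) : X)‖ ^ 2 + (form (v m - v n) (v m - v n)).re) < ε) →
    ∃ x : dom, Tendsto (fun n => √(‖((v n - x : dom) : X)‖ ^ 2 + (form (v n - x) (v n - x)).re)) atTop (𝓝 0)

namespace ClosedPositiveForm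

variable {X : Type*} [NormedAddCommGroup X] [InnerProductSpace ℂ X]

theorem form_self_nonneg (h : ClosedPositiveForm X) (x : h.dom) : 0 ≤ h.form x x := by
  by_cases hx : x = 0
  · simp [hx]
  · exact (h.pos x hx).le

theorem form_symm (h : ClosedPositiveForm X) (x y : h.dom) :
    (starRingEnd ℂ) (h.form x y) = h.form y x := by
  have im0 : ∀ z : h.dom, (h.form z z).im = 0 := fun z =>
    (Complex.le_def.1 (h.form_self_nonneg z)).2.symm
  have h1 := im0 (x + y)
  have h2 := im0 (x + Complex.I • y)
  simp only [map_add, LinearMap.add_apply, map_smul, map_smulₛₗ, LinearMap.smul_apply,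
    smul_eq_mul, Complex.add_im, Complex.add_re, Complex.mul_im, Complex.mul_re, Complex.conj_I, Complex.I_re,
    Complex.I_im, Complex.neg_re, Complex.neg_im, im0] at h1 h2
  apply Complex.ext
  · rw [Complex.conj_re]; linarith
  · rw [Complex.conj_im]; linarith

/-- The domain of `h`, to carry the norm `‖x‖_h = h(x, x)^(1/2)`. -/
def EnergyDom (h : ClosedPositiveForm X) : Type _ := h.dom

instance (h : ClosedPositiveForm X) : AddCommGroup h.EnergyDom :=
  inferInstanceAs (AddCommGroup h.dom)

instance (h : ClosedPositiveForm X) : Module ℂ h.EnergyDom :=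
  inferInstanceAs (Module ℂ h.dom)

/-- The inner product `⟨x, y⟩_h = h(x, y)`. -/
abbrev innerCore (h : ClosedPositiveForm X) : InnerProductSpace.Core ℂ h.EnergyDom where
  inner x y := h.form y x
  conj_inner_symm x y := h.form_symm x y
  re_inner_nonneg x := (Complex.le_def.1 (h.form_self_nonneg x)).1
  add_left x y z := map_add (h.form z) x y
  smul_left x y r := (h.form y).map_smulₛₗ r x
  definite x hx := by
    by_contra hne
    exact (h.pos x hne).ne' hx

instance (h : ClosedPositiveForm X) : NormedAddCommGroup h.EnergyDom :=
  h.innerCore.toNormedAddCommGroup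

instance (h : ClosedPositiveForm X) : InnerProductSpace ℂ h.EnergyDom :=
  InnerProductSpace.ofCore h.innerCore.toCore

/-- The energetic space `X_h`: the completion of `dom h` for `‖x‖_h = h(x, x)^(1/2)`. -/
abbrev EnergeticSpace (h : ClosedPositiveForm X) : Type _ :=
  UniformSpace.Completion h.EnergyDom

/-- The embedding of `dom h` into the energetic space. -/
def toEnergetic (h : ClosedPositiveForm X) : h.dom →ₗ[ℂ] h.EnergeticSpace :=
  (UniformSpace.Completion.toComplL (𝕜 := ℂ) (E := h.EnergyDom)).toLinearMap

theorem inner_toEnergetic (h : ClosedPositiveForm X) (x y : h.dom) :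
    inner ℂ (h.toEnergetic y) (h.toEnergetic x) = h.form x y :=
  UniformSpace.Completion.inner_coe (𝕜 := ℂ) (E := h.EnergyDom) y x

theorem norm_sq_toEnergetic (h : ClosedPositiveForm X) (x : h.dom) :
    ‖h.toEnergetic x‖ ^ 2 = (h.form x x).re := by
  rw [← h.inner_toEnergetic, inner_self_eq_norm_sq_to_K]
  norm_cast

theorem denseRange_toEnergetic (h : ClosedPositiveForm X) : DenseRange h.toEnergetic :=
  UniformSpace.Completion.denseRange_coe (α := h.EnergyDom)

/-- The Hamiltonian `x ↦ ½ h(x, x)`, continuously extended to the energetic space. -/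
def hamiltonian (h : ClosedPositiveForm X) (x : h.EnergeticSpace) : ℝ := 1 / 2 * ‖x‖ ^ 2

theorem hamiltonian_toEnergetic (h : ClosedPositiveForm X) (x : h.dom) :
    h.hamiltonian (h.toEnergetic x) = 1 / 2 * (h.form x x).re := by
  rw [hamiltonian, norm_sq_toEnergetic]

/-- The graph of the operator `H` associated with `h`: the pairs `(x, f)` with `x ∈ dom h` and
`h(x, y) = ⟨f, y⟩` for all `y ∈ dom h`. -/
def operatorGraph (h : ClosedPositiveForm X) : Submodule ℂ (X × X) where
  carrier := {p | ∃ hx : p.1 ∈ h.dom, ∀ y : h.dom, h.form ⟨p.1, hx⟩ y = inner ℂ (y : X) p.2}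
  zero_mem' := ⟨h.dom.zero_mem, fun y => by
    have : (⟨(0 : X × X).1, h.dom.zero_mem⟩ : h.dom) = 0 := rfl
    rw [this]; simp⟩
  add_mem' := by
    rintro ⟨a, b⟩ ⟨c, d⟩ ⟨ha, hb⟩ ⟨hc, hd⟩
    refine ⟨h.dom.add_mem ha hc, fun y => ?_⟩
    have : (⟨((a, b) + (c, d) : X × X).1, h.dom.add_mem ha hc⟩ : h.dom) = ⟨a, ha⟩ + ⟨c, hc⟩ := rfl
    rw [this, map_add, LinearMap.add_apply, hb, hd]
    exact (inner_add_right _ _ _).symm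
  smul_mem' := by
    rintro r ⟨a, b⟩ ⟨ha, hb⟩
    refine ⟨h.dom.smul_mem r ha, fun y => ?_⟩
    have : (⟨(r • (a, b) : X × X).1, h.dom.smul_mem r ha⟩ : h.dom) = r • ⟨a, ha⟩ := rfl
    rw [this, map_smul, LinearMap.smul_apply, hb]
    exact (inner_smul_right _ _ _).symm

/-- The positive self-adjoint operator `H` associated with `h`. -/
def operator (h : ClosedPositiveForm X) : X →ₗ.[ℂ] X := h.operatorGraph.toLinearPMap

theorem operatorGraph_unique (h : ClosedPositiveForm X) (p : X × X) (hp : p ∈ h.operatorGraph)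
    (hp0 : p.1 = 0) : p.2 = 0 := by
  obtain ⟨hx, hy⟩ := hp
  have h0 : (⟨p.1, hx⟩ : h.dom) = 0 := Subtype.ext hp0
  refine h.dense_dom.eq_zero_of_inner_right ℂ fun v hv => ?_
  rw [← hy ⟨v, hv⟩, h0]; simp

theorem graph_operator (h : ClosedPositiveForm X) : h.operator.graph = h.operatorGraph :=
  Submodule.toLinearPMap_graph_eq _ h.operatorGraph_unique

/-- Kato's description of the operator associated with `h`: if `R` is self-adjoint with domain
`dom h` and `h(x, y) = ⟨R x, R y⟩`, then `H = R ∘ R`; so `R` is the square root of `H`. -/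
theorem mem_graph_operator_iff_sqrt [CompleteSpace X] (h : ClosedPositiveForm X) (R : X →ₗ.[ℂ] X)
    (hR : R.adjoint = R) (hdom : R.domain = h.dom)
    (hform : ∀ (x y : X) (hx : x ∈ h.dom) (hy : y ∈ h.dom), h.form ⟨x, hx⟩ ⟨y, hy⟩ =
      inner ℂ (R ⟨y, hdom ▸ hy⟩) (R ⟨x, hdom ▸ hx⟩)) (x f : X) :
    (x, f) ∈ h.operator.graph ↔ ∃ z, (x, z) ∈ R.graph ∧ (z, f) ∈ R.graph := by
  have hdense : Dense (R.domain : Set X) := hdom ▸ h.dense_dom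
  rw [graph_operator]
  constructor
  · rintro ⟨hx, hf⟩
    have hx' : x ∈ R.domain := hdom ▸ hx
    refine ⟨R ⟨x, hx'⟩, R.mem_graph ⟨x, hx'⟩, ?_⟩
    have key : ∀ y : R.domain, inner ℂ f (y : X) = inner ℂ (R ⟨x, hx'⟩) (R y) := by
      rintro ⟨y, hy⟩
      rw [← inner_conj_symm, ← hf ⟨y, hdom ▸ hy⟩, hform, inner_conj_symm]
    have hmem := R.mem_adjoint_domain_of_exists (R ⟨x, hx'⟩) ⟨f, key⟩
    have hval := R.adjoint_apply_eq hdense ⟨_, hmem⟩ key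
    have hg := R.adjoint.mem_graph ⟨_, hmem⟩
    rw [hval, congrArg LinearPMap.graph hR] at hg
    exact hg
  · rintro ⟨z, hz, hf⟩
    obtain ⟨⟨x', hx'⟩, rfl, rfl⟩ := (LinearPMap.mem_graph_iff _).1 hz
    refine ⟨hdom ▸ hx', ?_⟩
    rintro ⟨y, hy⟩
    rw [hform]
    obtain ⟨w, hw, rfl⟩ := (LinearPMap.mem_graph_iff _).1 hf
    have := R.adjoint_isFormalAdjoint hdense
    rw [hR] at this
    have h2 := this ⟨y, hdom ▸ hy⟩ w
    rw [hw] at h2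
    exact h2

/-- The pairs `(x, x)` in `X × X_h`, `x ∈ dom h`. -/
def graphSpace (h : ClosedPositiveForm X) : Submodule ℂ (WithLp 2 (X × h.EnergeticSpace)) :=
  LinearMap.range ((WithLp.linearEquiv 2 ℂ (X × h.EnergeticSpace)).symm.toLinearMap.comp
    (h.dom.subtype.prod h.toEnergetic))

theorem mem_graphSpace (h : ClosedPositiveForm X) (x : h.dom) :
    WithLp.toLp 2 ((x : X), h.toEnergetic x) ∈ h.graphSpace := ⟨x, rfl⟩

theorem isClosed_graphSpace (h : ClosedPositiveForm X) :
    IsClosed (h.graphSpace : Set (WithLp 2 (X × h.EnergeticSpace))) := by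
  have hn : ∀ x : h.dom, √(‖(x : X)‖ ^ 2 + (h.form x x).re) =
      ‖WithLp.toLp 2 ((x : X), h.toEnergetic x)‖ := by
    intro x
    rw [← norm_sq_toEnergetic, WithLp.prod_norm_eq_of_L2]
    rfl
  have hs : ∀ x y : h.dom, WithLp.toLp 2 (((x - y : h.dom) : X), h.toEnergetic (x - y)) =
      WithLp.toLp 2 ((x : X), h.toEnergetic x) - WithLp.toLp 2 ((y : X), h.toEnergetic y) := by
    intro x y
    rw [map_sub]; rfl
  refine IsSeqClosed.isClosed ?_
  intro w p hw hp
  choose v hv using hw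
  have hv' : w = fun n => WithLp.toLp 2 ((v n : X), h.toEnergetic (v n)) :=
    funext fun n => (hv n).symm
  subst hv'
  obtain ⟨x, hx⟩ := h.complete v (by
    intro ε hε
    obtain ⟨N, hN⟩ := Metric.cauchySeq_iff.1 hp.cauchySeq ε hε
    refine ⟨N, fun m hm n hn' => ?_⟩
    rw [hn, hs, ← dist_eq_norm]
    exact hN m hm n hn')
  have hx' : Tendsto (fun n => WithLp.toLp 2 ((v n : X), h.toEnergetic (v n))) atTop
      (𝓝 (WithLp.toLp 2 ((x : X), h.toEnergetic x))) := by
    rw [tendsto_iff_norm_sub_tendsto_zero]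
    refine hx.congr fun n => ?_
    rw [hn, hs]
  rw [tendsto_nhds_unique hp hx']
  exact h.mem_graphSpace x

/-- Orthogonal projection onto the graph space: for all `f ∈ X`, `z ∈ X_h` there is `w ∈ dom h`
with `⟨w, y⟩ + h(w, y) = ⟨f, y⟩ + ⟨z, y⟩_h` for all `y ∈ dom h`. -/
theorem exists_graph_projection [CompleteSpace X] (h : ClosedPositiveForm X) (f : X)
    (z : h.EnergeticSpace) : ∃ w : h.dom, ∀ y : h.dom,
      inner ℂ (y : X) (w : X) + h.form w y =
        inner ℂ (y : X) f + inner ℂ (h.toEnergetic y) z := by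
  have : CompleteSpace h.graphSpace := h.isClosed_graphSpace.completeSpace_coe
  obtain ⟨v, ⟨w, rfl⟩, q, hq, hvq⟩ :=
    h.graphSpace.exists_add_mem_mem_orthogonal (WithLp.toLp 2 (f, z))
  refine ⟨w, fun y => ?_⟩
  have := (Submodule.mem_orthogonal _ _).1 hq _ (h.mem_graphSpace y)
  have hq' : q = WithLp.toLp 2 (f, z) - WithLp.toLp 2 ((w : X), h.toEnergetic w) := by
    rw [hvq]; simp only [LinearMap.comp_apply]; exact (add_sub_cancel_left _ _).symm
  rw [hq', inner_sub_right, WithLp.prod_inner_apply, WithLp.prod_inner_apply,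
    sub_eq_zero] at this
  rw [← inner_toEnergetic]
  exact this.symm

theorem dense_operator_domain [CompleteSpace X] (h : ClosedPositiveForm X) (z : h.EnergeticSpace)
    (hz : ∀ p ∈ h.operator.graph, ∀ hp : p.1 ∈ h.dom,
      inner ℂ (h.toEnergetic ⟨p.1, hp⟩) z = 0) : z = 0 := by
  obtain ⟨v, hv⟩ := h.exists_graph_projection 0 z
  have hv0 : v = 0 := by
    obtain ⟨w, hw⟩ := h.exists_graph_projection v 0
    have hwg : ((w : X), (v : X) - w) ∈ h.operator.graph := by
      rw [graph_operator]
      refine ⟨w.2, fun y => ?_⟩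
      have := hw y
      rw [inner_zero_right, add_zero] at this
      rw [inner_sub_right]
      exact eq_sub_of_add_eq' this
    have h1 := hv w
    rw [hz _ hwg w.2, inner_zero_right, add_zero] at h1
    have h2 := hw v
    rw [inner_zero_right, add_zero] at h2
    rw [← inner_conj_symm, ← h.form_symm, ← map_add, h2] at h1
    have : inner ℂ (v : X) (v : X) = 0 := by simpa using h1
    exact Subtype.ext (inner_self_eq_zero.1 this)
  refine h.denseRange_toEnergetic.eq_zero_of_inner_right ℂ ?_
  intro y
  have := hv y
  rw [hv0] at this
  simpa using this.symm

/-- `H` extends uniquely to a bounded operator `X_h → X_h^*`. An element `f = H x` of `X` is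
regarded as an element of `X_h^*` through the pivot space: as the functional which is
`y ↦ ⟨f, y⟩` on `dom h`. -/
theorem existsUnique_energeticExtension [CompleteSpace X] (h : ClosedPositiveForm X) :
    ∃! Ht : h.EnergeticSpace →L[ℂ] AntiDual h.EnergeticSpace,
      ∀ (x : h.dom) (f : X), ((x : X), f) ∈ h.operator.graph →
        ∀ y : h.dom, Ht (h.toEnergetic x) (h.toEnergetic y) = inner ℂ (y : X) f := by
  have hex : ∀ (x : h.dom) (f : X), ((x : X), f) ∈ h.operator.graph →
      ∀ y : h.dom, rieszMap h.EnergeticSpace (h.toEnergetic x) (h.toEnergetic y) =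
        inner ℂ (y : X) f := by
    intro x f hxf y
    rw [graph_operator] at hxf
    obtain ⟨hx, hf⟩ := hxf
    rw [rieszMap_apply, inner_toEnergetic]
    exact hf y
  refine ⟨rieszMap _, hex, fun T hT => ?_⟩
  have key : ∀ y : h.dom, (T - rieszMap h.EnergeticSpace).flip (h.toEnergetic y) = 0 := by
    intro y
    rw [← (InnerProductSpace.toDual ℂ h.EnergeticSpace).symm.map_eq_zero_iff]
    refine h.dense_operator_domain _ fun p hp hpd => ?_
    rw [← inner_conj_symm, InnerProductSpace.toDual_symm_apply]
    have h1 := hT ⟨p.1, hpd⟩ p.2 hp y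
    have h2 := hex ⟨p.1, hpd⟩ p.2 hp y
    simp [h1, h2]
  ext a b
  refine congrFun (h.denseRange_toEnergetic.equalizer (T a).continuous
    (rieszMap h.EnergeticSpace a).continuous (funext fun y => ?_)) b
  have := DFunLike.congr_fun (key y) a
  exact sub_eq_zero.1 this

/-- The energetic extension of the operator associated with `h`. -/
def energeticExtension [CompleteSpace X] (h : ClosedPositiveForm X) :
    h.EnergeticSpace →L[ℂ] AntiDual h.EnergeticSpace :=
  h.existsUnique_energeticExtension.choose

theorem energeticExtension_spec [CompleteSpace X] (h : ClosedPositiveForm X)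
    (x : h.dom) (f : X) (hxf : ((x : X), f) ∈ h.operator.graph) (y : h.dom) :
    h.energeticExtension (h.toEnergetic x) (h.toEnergetic y) = inner ℂ (y : X) f :=
  h.existsUnique_energeticExtension.choose_spec.1 x f hxf y

end ClosedPositiveForm

/-! ### Dissipation nodes and port-Hamiltonian system nodes -/

section Dissipation

variable {E U : Type*} [NormedAddCommGroup E] [InnerProductSpace ℂ E]
  [NormedAddCommGroup U] [InnerProductSpace ℂ U]

/-- The duality product `⟨w, z⟩` of `w ∈ E × U^*` and `z ∈ E^* × U`, linear in `w` and antilinear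
in `z`, where `E × U^*` is regarded as the anti-dual of `E^* × U`. -/
def blockPairing (w : E × AntiDual U) (z : AntiDual E × U) : ℂ :=
  (starRingEnd ℂ) (z.1 w.1) + w.2 z.2

/-- `⟨M z, z⟩` for `z ∈ dom M` (and `0` otherwise). -/
def powerOf (M : (AntiDual E × U) →ₗ.[ℂ] (E × AntiDual U)) (z : AntiDual E × U) : ℂ :=
  blockPairing (M.evalZero z) z

/-- Dissipation nodes on `(E, U)`. -/
structure IsDissipationNode [CompleteSpace E]
    (M : (AntiDual E × U) →ₗ.[ℂ] (E × AntiDual U)) : Prop where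
  closed : M.IsClosed
  dissipative : ∀ z : M.domain, (blockPairing (M z) z).re ≤ 0
  upperRow_closed : (upperRow M).IsClosed
  exists_effort : ∀ u : U, ∃ x' : AntiDual E, (x', u) ∈ M.domain
  dense_range : ∃ l : ℂ, 0 < l.re ∧
    DenseRange fun x' : (mainOperator M).domain =>
      l • (rieszEquiv E).symm (x' : AntiDual E) - mainOperator M x'

end Dissipation

/-- The port-Hamiltonian system node `diag(I, -I) M diag(Ht, I)`, with domain
`{(x, u) | (Ht x, u) ∈ dom M}`, where `Ht` is the energetic extension. -/
def portHamiltonianNode {X U : Type*} [NormedAddCommGroup X] [InnerProductSpace ℂ X]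
    [CompleteSpace X] [NormedAddCommGroup U] [InnerProductSpace ℂ U] (h : ClosedPositiveForm X)
    (M : (AntiDual h.EnergeticSpace × U) →ₗ.[ℂ] (h.EnergeticSpace × AntiDual U)) :
    (h.EnergeticSpace × U) →ₗ.[ℂ] (h.EnergeticSpace × AntiDual U) :=
  (LinearMap.prodMap LinearMap.id (-LinearMap.id)).compPMap
    (precompPMap M (LinearMap.prodMap h.energeticExtension.toLinearMap LinearMap.id))

end

noncomputable section

/-! ### Exponentials of bounded generators of contraction semigroups -/

section BoundedGenerators

variable {X : Type*} [NormedAddCommGroup X] [NormedSpace ℂ X]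

/-- `exp (t B)` is a contraction for all `t ≥ 0`. -/
def ContractiveExp (B : X →L[ℂ] X) : Prop :=
  ∀ t : ℝ, 0 ≤ t → ‖NormedSpace.exp (t • B)‖ ≤ 1

theorem ContractiveExp.norm_apply_le {B : X →L[ℂ] X} (hB : ContractiveExp B) {t : ℝ} (ht : 0 ≤ t)
    (x : X) : ‖NormedSpace.exp (t • B) x‖ ≤ ‖x‖ :=
  (ContinuousLinearMap.le_of_opNorm_le _ (hB t ht) x).trans_eq (one_mul _)

variable [CompleteSpace X]

theorem ContinuousLinearMap.norm_exp_le (B : X →L[ℂ] X) :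
    ‖NormedSpace.exp B‖ ≤ Real.exp ‖B‖ := by
  have h1 := NormedSpace.exp_series_hasSum_exp' (𝕂 := ℝ) B
  have h2 := NormedSpace.exp_series_hasSum_exp' (𝕂 := ℝ) ‖B‖
  rw [← Real.exp_eq_exp_ℝ] at h2
  rw [← h1.tsum_eq]
  refine tsum_of_norm_bounded h2 fun n => ?_
  rw [norm_smul, smul_eq_mul, Real.norm_of_nonneg (by positivity)]
  gcongr
  rcases Nat.eq_zero_or_pos n with rfl | hn
  · rw [pow_zero, pow_zero]
    exact ContinuousLinearMap.norm_id_le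
  · exact norm_pow_le' B hn

theorem hasDerivAt_exp_smul_apply (B : X →L[ℂ] X) (x : X) (t : ℝ) :
    HasDerivAt (fun s : ℝ => NormedSpace.exp (s • B) x) (NormedSpace.exp (t • B) (B x)) t := by
  have h := hasDerivAt_exp_smul_const (𝕂 := ℝ) B t
  have h2 := ((ContinuousLinearMap.apply ℂ X x).restrictScalars ℝ).hasFDerivAt.comp_hasDerivAt t h
  exact h2

theorem ContractiveExp.norm_exp_sub_exp_le {B C : X →L[ℂ] X} (hB : ContractiveExp B)
    (hC : ContractiveExp C) (hBC : Commute B C) {t : ℝ} (ht : 0 ≤ t) (x : X) :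
    ‖NormedSpace.exp (t • B) x - NormedSpace.exp (t • C) x‖ ≤ t * ‖B x - C x‖ := by
  have hfac : ∀ s : ℝ, NormedSpace.exp (t • C) * NormedSpace.exp (s • (B - C)) =
      NormedSpace.exp ((t - s) • C) * NormedSpace.exp (s • B) := by
    intro s
    let : NormedAlgebra ℚ (X →L[ℂ] X) := NormedAlgebra.restrictScalars ℚ ℝ _
    have hc : Commute C (B - C) := (hBC.symm).sub_right (Commute.refl C)
    rw [← NormedSpace.exp_add_of_commute ((hc.smul_left t).smul_right s),
      ← NormedSpace.exp_add_of_commute ((hBC.symm.smul_left (t - s)).smul_right s)]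
    congr 1
    rw [smul_sub, sub_smul]
    abel
  have hd : ∀ s : ℝ, HasDerivAt
      (fun s : ℝ => NormedSpace.exp (t • C) (NormedSpace.exp (s • (B - C)) x))
      (NormedSpace.exp (t • C) (NormedSpace.exp (s • (B - C)) ((B - C) x))) s := fun s =>
    ((NormedSpace.exp (t • C)).restrictScalars ℝ).hasFDerivAt.comp_hasDerivAt s
      (hasDerivAt_exp_smul_apply (B - C) x s)
  have hb : ∀ s ∈ Ico 0 t,
      ‖NormedSpace.exp (t • C) (NormedSpace.exp (s • (B - C)) ((B - C) x))‖ ≤ ‖B x - C x‖ := by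
    intro s hs
    rw [← mul_apply_eq_comp, hfac]
    exact (hC.norm_apply_le (sub_nonneg.2 hs.2.le) _).trans (hB.norm_apply_le hs.1 _)
  have := norm_image_sub_le_of_norm_deriv_le_segment' (fun s _ => (hd s).hasDerivWithinAt) hb t
    ⟨ht, le_rfl⟩
  rw [← mul_apply_eq_comp, hfac, mul_comm] at this
  simpa using this

theorem ContractiveExp.norm_exp_sub_self_le {B : X →L[ℂ] X} (hB : ContractiveExp B)
    {t : ℝ} (ht : 0 ≤ t) (x : X) : ‖NormedSpace.exp (t • B) x - x‖ ≤ t * ‖B x‖ := by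
  have := norm_image_sub_le_of_norm_deriv_le_segment' (a := 0) (b := t)
    (fun s _ => (hasDerivAt_exp_smul_apply B x s).hasDerivWithinAt)
    (fun s hs => hB.norm_apply_le hs.1 (B x)) t ⟨ht, le_rfl⟩
  simpa [mul_comm] using this

theorem ContractiveExp.norm_exp_sub_self_sub_le {B : X →L[ℂ] X} (hB : ContractiveExp B)
    {t : ℝ} (ht : 0 ≤ t) (x : X) :
    ‖NormedSpace.exp (t • B) x - x - t • B x‖ ≤ t ^ 2 * ‖B (B x)‖ := by
  have := norm_image_sub_le_of_norm_deriv_le_segment' (a := 0) (b := t)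
    (f := fun s : ℝ => NormedSpace.exp (s • B) x - s • B x)
    (f' := fun s => NormedSpace.exp (s • B) (B x) - (1 : ℝ) • B x) (C := t * ‖B (B x)‖)
    (fun s _ => ((hasDerivAt_exp_smul_apply B x s).sub
      ((hasDerivAt_id s).smul_const (B x))).hasDerivWithinAt)
    (fun s hs => by
      rw [one_smul]
      exact (hB.norm_exp_sub_self_le hs.1 (B x)).trans (by gcongr; exact hs.2.le)) t ⟨ht, le_rfl⟩
  refine le_trans (le_of_eq ?_) (this.trans_eq (by ring))
  congr 1
  simp
  abel

end BoundedGenerators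

/-! ### The Hille–Yosida theorem for contraction semigroups -/

section HilleYosida

variable {X : Type*} [NormedAddCommGroup X] [NormedSpace ℂ X]

theorem IsResolventAt.eq_add_smul_mul {A : X →ₗ.[ℂ] X} {s r : ℂ} {R Q : X →L[ℂ] X}
    (hR : IsResolventAt A s R) (hQ : IsResolventAt A r Q) : Q = R + (s - r) • (R * Q) := by
  ext z
  obtain ⟨hz, hz'⟩ := hQ.right_inv z
  have h1 := hR.left_inv ⟨Q z, hz⟩
  have h2 : s • Q z - A ⟨Q z, hz⟩ = (s - r) • Q z + z := by
    calc s • Q z - A ⟨Q z, hz⟩ = (s - r) • Q z + (r • Q z - A ⟨Q z, hz⟩) := by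
          rw [sub_smul]; abel
      _ = (s - r) • Q z + z := by rw [hz']
  simp only at h1
  rw [h2, map_add, map_smul] at h1
  simp only [add_apply, smul_apply, mul_apply_eq_comp]
  rw [add_comm]
  exact h1.symm

theorem IsResolventAt.commute {A : X →ₗ.[ℂ] X} {s r : ℂ} {R Q : X →L[ℂ] X}
    (hR : IsResolventAt A s R) (hQ : IsResolventAt A r Q) : Commute R Q := by
  have h1 := hR.eq_add_smul_mul hQ
  have h2 := hQ.eq_add_smul_mul hR
  by_cases hsr : s = r
  · subst hsr
    simp only [sub_self, zero_smul, add_zero] at h1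
    rw [h1]
  · have h3 : (s - r) • (R * Q) = (s - r) • (Q * R) := by
      rw [← sub_eq_iff_eq_add'.2 h1, ← neg_sub r s, neg_smul, ← sub_eq_iff_eq_add'.2 h2, neg_sub]
    exact smul_right_injective _ (sub_ne_zero.2 hsr) h3

theorem ContinuousLinearMap.tendsto_zero_of_dense {ι : Type*} {f : Filter ι}
    {g : ι → X →L[ℂ] X} {K : ℝ} (hg : ∀ᶠ i in f, ‖g i‖ ≤ K) {D : Set X} (hD : Dense D)
    (h : ∀ d ∈ D, Tendsto (fun i => g i d) f (𝓝 0)) (x : X) :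
    Tendsto (fun i => g i x) f (𝓝 0) := by
  rw [Metric.tendsto_nhds]
  intro ε hε
  obtain ⟨d, hd, hxd⟩ := Metric.dense_iff.1 hD x (ε / (2 * (|K| + 1))) (by positivity)
  filter_upwards [hg, Metric.tendsto_nhds.1 (h d hxd) (ε / 2) (half_pos hε)] with i hi hi'
  rw [dist_zero_right] at hi' ⊢
  have h1 : ‖g i (x - d)‖ ≤ K * ‖x - d‖ := (g i).le_of_opNorm_le hi _
  have h2 : ‖x - d‖ < ε / (2 * (|K| + 1)) := by
    rw [← dist_eq_norm, dist_comm]; exact hd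
  have h3 : K * ‖x - d‖ ≤ ε / 2 := by
    calc K * ‖x - d‖ ≤ (|K| + 1) * (ε / (2 * (|K| + 1))) := by
          gcongr
          linarith [le_abs_self K]
      _ = ε / 2 := by field_simp
  calc ‖g i x‖ = ‖g i (x - d) + g i d‖ := by rw [← map_add, sub_add_cancel]
    _ ≤ ‖g i (x - d)‖ + ‖g i d‖ := norm_add_le _ _
    _ < ε := by linarith

/-- The Yosida approximation `l A (l I - A)⁻¹ = l (l R - I)` with `R = (l I - A)⁻¹`. -/
def yosidaApprox (R : ℝ → X →L[ℂ] X) (l : ℝ) : X →L[ℂ] X := (l : ℂ) • ((l : ℂ) • R l - 1)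

theorem yosidaApprox_apply {A : X →ₗ.[ℂ] X} {R : ℝ → X →L[ℂ] X} {l : ℝ}
    (hR : IsResolventAt A l (R l)) (x : A.domain) :
    yosidaApprox R l x = (l : ℂ) • R l (A x) := by
  have h := hR.left_inv x
  rw [map_sub, map_smul] at h
  simp only [yosidaApprox, smul_apply, sub_apply, one_apply_eq_self]
  rw [sub_eq_iff_eq_add.1 h, add_sub_cancel_left]

theorem contractiveExp_yosidaApprox [CompleteSpace X] {R : ℝ → X →L[ℂ] X} {l : ℝ} (hl : 0 < l)
    (hR : ‖R l‖ ≤ l⁻¹) : ContractiveExp (yosidaApprox R l) := by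
  intro t ht
  let : NormedAlgebra ℚ (X →L[ℂ] X) := NormedAlgebra.restrictScalars ℚ ℝ _
  have h1 : t • yosidaApprox R l =
      (t * l ^ 2) • R l + algebraMap ℝ (X →L[ℂ] X) (-(t * l)) := by
    ext x
    simp only [yosidaApprox, smul_apply, sub_apply, one_apply_eq_self, add_apply,
      Algebra.algebraMap_eq_smul_one, Complex.coe_smul, smul_sub, smul_smul, neg_smul]
    rw [sub_eq_add_neg]
    congr 2
    ring
  rw [h1, NormedSpace.exp_add_of_commute (Algebra.commutes _ _).symm,
    ← NormedSpace.algebraMap_exp_comm, ← Real.exp_eq_exp_ℝ]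
  have h2 : ‖NormedSpace.exp ((t * l ^ 2) • R l)‖ ≤ Real.exp (t * l) := by
    refine (ContinuousLinearMap.norm_exp_le _).trans (Real.exp_le_exp.2 ?_)
    rw [norm_smul, Real.norm_of_nonneg (by positivity)]
    calc t * l ^ 2 * ‖R l‖ ≤ t * l ^ 2 * l⁻¹ := by gcongr
      _ = t * l := by field_simp
  have h3 : ‖algebraMap ℝ (X →L[ℂ] X) (Real.exp (-(t * l)))‖ ≤ Real.exp (-(t * l)) := by
    rw [Algebra.algebraMap_eq_smul_one, norm_smul, Real.norm_of_nonneg (Real.exp_pos _).le]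
    exact mul_le_of_le_one_right (Real.exp_pos _).le ContinuousLinearMap.norm_id_le
  calc _ ≤ Real.exp (t * l) * Real.exp (-(t * l)) :=
        (norm_mul_le _ _).trans (mul_le_mul h2 h3 (norm_nonneg _) (Real.exp_pos _).le)
    _ = 1 := by rw [← Real.exp_add, add_neg_cancel, Real.exp_zero]

theorem norm_smul_resolvent_le {R : ℝ → X →L[ℂ] X} {l : ℝ} (hl : 0 < l) (hR : ‖R l‖ ≤ l⁻¹) :
    ‖(l : ℂ) • R l‖ ≤ 1 := by
  rw [norm_smul, Complex.norm_real, Real.norm_of_nonneg hl.le]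
  calc l * ‖R l‖ ≤ l * l⁻¹ := by gcongr
    _ = 1 := mul_inv_cancel₀ hl.ne'

theorem tendsto_smul_resolvent {A : X →ₗ.[ℂ] X} (hA : Dense (A.domain : Set X))
    {R : ℝ → X →L[ℂ] X} (hR : ∀ l : ℝ, 0 < l → IsResolventAt A (l : ℂ) (R l))
    (hRn : ∀ l, 0 < l → ‖R l‖ ≤ l⁻¹) (x : X) :
    Tendsto (fun l : ℝ => (l : ℂ) • R l x) atTop (𝓝 x) := by
  have key := ContinuousLinearMap.tendsto_zero_of_dense (f := atTop) (K := 1 + ‖(1 : X →L[ℂ] X)‖)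
    (g := fun l : ℝ => (l : ℂ) • R l - 1) ?_ hA ?_ x
  · have := key.add_const x
    simpa using this
  · filter_upwards [eventually_gt_atTop 0] with l hl
    exact (norm_sub_le _ _).trans (by gcongr; exact norm_smul_resolvent_le hl (hRn l hl))
  · intro d hd
    have hlim : Tendsto (fun l : ℝ => l⁻¹ * ‖A ⟨d, hd⟩‖) atTop (𝓝 0) := by
      simpa using tendsto_inv_atTop_zero.mul_const ‖A ⟨d, hd⟩‖
    refine squeeze_zero_norm' ?_ hlim
    filter_upwards [eventually_gt_atTop 0] with l hl
    have h := (hR l hl).left_inv ⟨d, hd⟩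
    rw [map_sub, map_smul] at h
    simp only [smul_apply, sub_apply, one_apply_eq_self]
    rw [sub_eq_iff_eq_add.1 h, add_sub_cancel_left]
    exact (R l).le_of_opNorm_le (hRn l hl) _

theorem tendsto_yosidaApprox {A : X →ₗ.[ℂ] X} (hA : Dense (A.domain : Set X))
    {R : ℝ → X →L[ℂ] X} (hR : ∀ l : ℝ, 0 < l → IsResolventAt A (l : ℂ) (R l))
    (hRn : ∀ l, 0 < l → ‖R l‖ ≤ l⁻¹) (x : A.domain) :
    Tendsto (fun l : ℝ => yosidaApprox R l x) atTop (𝓝 (A x)) := by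
  refine (tendsto_smul_resolvent hA hR hRn (A x)).congr' ?_
  filter_upwards [eventually_gt_atTop 0] with l hl
  exact (yosidaApprox_apply (hR l hl) x).symm

theorem commute_yosidaApprox {A : X →ₗ.[ℂ] X} {R : ℝ → X →L[ℂ] X}
    (hR : ∀ l : ℝ, 0 < l → IsResolventAt A (l : ℂ) (R l)) {l m : ℝ} (hl : 0 < l) (hm : 0 < m) :
    Commute (yosidaApprox R l) (yosidaApprox R m) := by
  have h := (hR l hl).commute (hR m hm)
  unfold yosidaApprox
  refine Commute.smul_left (Commute.smul_right ?_ _) _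
  exact ((((h.smul_left _).smul_right _).sub_left (Commute.one_left _)).sub_right
    (Commute.one_right _))

variable [CompleteSpace X]

theorem exists_tendsto_exp_yosidaApprox {A : X →ₗ.[ℂ] X} (hA : Dense (A.domain : Set X))
    {R : ℝ → X →L[ℂ] X} (hR : ∀ l : ℝ, 0 < l → IsResolventAt A (l : ℂ) (R l))
    (hRn : ∀ l, 0 < l → ‖R l‖ ≤ l⁻¹) {t : ℝ} (ht : 0 ≤ t) :
    ∃ L : X →L[ℂ] X, ∀ x, Tendsto (fun l => NormedSpace.exp (t • yosidaApprox R l) x) atTop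
      (𝓝 (L x)) := by
  have hc : ∀ l, 0 < l → ContractiveExp (yosidaApprox R l) := fun l hl =>
    contractiveExp_yosidaApprox hl (hRn l hl)
  have hpos : ∀ᶠ p : ℝ × ℝ in atTop, 0 < p.1 ∧ 0 < p.2 := by
    rw [← prod_atTop_atTop_eq]
    exact (eventually_gt_atTop 0).prod_mk (eventually_gt_atTop 0)
  have hlim : ∀ x, ∃ z, Tendsto (fun l => NormedSpace.exp (t • yosidaApprox R l) x) atTop
      (𝓝 z) := by
    intro x
    refine cauchySeq_tendsto_of_complete ?_
    rw [cauchySeq_iff_tendsto_dist_atTop_0]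
    have key := ContinuousLinearMap.tendsto_zero_of_dense (f := (atTop : Filter (ℝ × ℝ)))
      (K := 1 + 1) (g := fun p => NormedSpace.exp (t • yosidaApprox R p.1) -
        NormedSpace.exp (t • yosidaApprox R p.2)) ?_ hA ?_ x
    · simpa [dist_eq_norm] using key.norm
    · filter_upwards [hpos] with p hp
      exact (norm_sub_le _ _).trans (add_le_add (hc _ hp.1 t ht) (hc _ hp.2 t ht))
    · intro d hd
      have h1 := (tendsto_yosidaApprox hA hR hRn ⟨d, hd⟩)
      have h2 : Tendsto (fun p : ℝ × ℝ => t * ‖yosidaApprox R p.1 d - yosidaApprox R p.2 d‖)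
          atTop (𝓝 0) := by
        rw [← prod_atTop_atTop_eq]
        have := (((h1.comp (tendsto_fst (g := atTop))).sub (h1.comp (tendsto_snd (f := atTop)))).norm).const_mul t
        simpa using this
      refine squeeze_zero_norm' ?_ h2
      filter_upwards [hpos] with p hp
      exact (hc _ hp.1).norm_exp_sub_exp_le (hc _ hp.2) (commute_yosidaApprox hR hp.1 hp.2) ht d
  choose f hf using hlim
  exact ⟨continuousLinearMapOfTendsto (l := atTop)
    (fun l : ℝ => NormedSpace.exp (t • yosidaApprox R l)) (f := f) (tendsto_pi_nhds.2 hf), hf⟩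

/-- The generator of a contraction semigroup is dissipative: `1` is not an eigenvalue. -/
theorem eq_zero_of_tendsto_of_contraction {Y : Type*} [NormedAddCommGroup Y] [NormedSpace ℂ Y]
    {T : ℝ → Y →L[ℂ] Y} (hT : ∀ t, 0 ≤ t → ‖T t‖ ≤ 1) {v : Y}
    (hv : Tendsto (fun t : ℝ => t⁻¹ • (T t v - v)) (𝓝[>] 0) (𝓝 v)) : v = 0 := by
  have h1 : Tendsto (fun t : ℝ => ‖t⁻¹ • (T t v - v) - v‖) (𝓝[>] 0) (𝓝 0) := by
    simpa using (hv.sub_const v).norm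
  refine norm_le_zero_iff.1 (ge_of_tendsto h1 ?_)
  filter_upwards [self_mem_nhdsWithin] with t (ht : 0 < t)
  have h2 : t⁻¹ • (T t v - v) - v = t⁻¹ • (T t v - (1 + t) • v) := by
    rw [add_smul, one_smul, ← sub_sub, smul_sub t⁻¹ (T t v - v), smul_smul, inv_mul_cancel₀ ht.ne',
      one_smul]
  have h3 : ‖T t v‖ ≤ ‖v‖ := ((T t).le_of_opNorm_le (hT t ht.le) v).trans_eq (one_mul _)
  have h4 : ‖(1 + t) • v‖ - ‖T t v‖ ≤ ‖T t v - (1 + t) • v‖ := by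
    rw [norm_sub_rev]; exact norm_sub_norm_le _ _
  rw [norm_smul, Real.norm_of_nonneg (by positivity)] at h4
  rw [h2, norm_smul, Real.norm_of_nonneg (by positivity), le_inv_mul_iff₀ ht]
  linarith

/-- The Hille–Yosida theorem for contraction semigroups. -/
theorem generatesContractionSemigroup_of_resolvent_bound {A : X →ₗ.[ℂ] X}
    (hA : Dense (A.domain : Set X)) {R : ℝ → X →L[ℂ] X}
    (hR : ∀ l : ℝ, 0 < l → IsResolventAt A (l : ℂ) (R l))
    (hRn : ∀ l, 0 < l → ‖R l‖ ≤ l⁻¹) : GeneratesContractionSemigroup A := by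
  have hc : ∀ l, 0 < l → ContractiveExp (yosidaApprox R l) := fun l hl =>
    contractiveExp_yosidaApprox hl (hRn l hl)
  have hex : ∀ t : ℝ, ∃ L : X →L[ℂ] X, 0 ≤ t → ∀ x,
      Tendsto (fun l => NormedSpace.exp (t • yosidaApprox R l) x) atTop (𝓝 (L x)) := by
    intro t
    by_cases ht : 0 ≤ t
    · obtain ⟨L, hL⟩ := exists_tendsto_exp_yosidaApprox hA hR hRn ht
      exact ⟨L, fun _ => hL⟩
    · exact ⟨0, fun h => absurd h ht⟩
  choose T hT using hex
  have hTn : ∀ t, 0 ≤ t → ‖T t‖ ≤ 1 := by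
    intro t ht
    refine ContinuousLinearMap.opNorm_le_bound _ zero_le_one fun x => ?_
    rw [one_mul]
    refine le_of_tendsto (hT t ht x).norm ?_
    filter_upwards [eventually_gt_atTop 0] with l hl
    exact (hc l hl).norm_apply_le ht x
  have hT1 : ∀ t, 0 ≤ t → ∀ x : A.domain, ‖T t x - x‖ ≤ t * ‖A x‖ := by
    intro t ht x
    refine le_of_tendsto_of_tendsto ((hT t ht x).sub_const _).norm
      ((tendsto_yosidaApprox hA hR hRn x).norm.const_mul t) ?_
    filter_upwards [eventually_gt_atTop 0] with l hl
    exact (hc l hl).norm_exp_sub_self_le ht x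
  have hT2 : ∀ t, 0 ≤ t → ∀ (x : A.domain) (hx : A x ∈ A.domain),
      ‖T t x - x - t • A x‖ ≤ t ^ 2 * ‖A ⟨A x, hx⟩‖ := by
    intro t ht x hx
    refine le_of_tendsto (((hT t ht x).sub_const _).sub
      ((tendsto_yosidaApprox hA hR hRn x).const_smul t)).norm ?_
    filter_upwards [eventually_gt_atTop 0] with l hl
    refine ((hc l hl).norm_exp_sub_self_sub_le ht x).trans ?_
    gcongr
    have hJ : ∀ z, ‖(l : ℂ) • R l z‖ ≤ ‖z‖ := fun z =>
      (((l : ℂ) • R l).le_of_opNorm_le (norm_smul_resolvent_le hl (hRn l hl)) z).trans_eq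
        (one_mul _)
    rw [yosidaApprox_apply (hR l hl) x, map_smul]
    have hcomm : Commute (yosidaApprox R l) (R l) :=
      (((Commute.refl (R l)).smul_left _).sub_left (Commute.one_left _)).smul_left _
    have h1 := DFunLike.congr_fun hcomm.eq (A x)
    rw [mul_apply_eq_comp, mul_apply_eq_comp, yosidaApprox_apply (hR l hl) ⟨A x, hx⟩] at h1
    rw [h1]
    exact (hJ _).trans (hJ _)
  have hcont : ∀ x : X, Tendsto (fun t => T t x) (𝓝[>] 0) (𝓝 x) := by
    intro x
    have key := ContinuousLinearMap.tendsto_zero_of_dense (f := 𝓝[>] (0 : ℝ))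
      (K := 1 + ‖(1 : X →L[ℂ] X)‖) (g := fun t => T t - 1) ?_ hA ?_ x
    · simpa using key.add_const x
    · filter_upwards [self_mem_nhdsWithin] with t (ht : 0 < t)
      exact (norm_sub_le _ _).trans (by gcongr; exact hTn t ht.le)
    · intro d hd
      have hlim : Tendsto (fun t : ℝ => t * ‖A ⟨d, hd⟩‖) (𝓝[>] 0) (𝓝 0) := by
        have := (tendsto_id (α := ℝ) (x := 𝓝 0)).mul_const ‖A ⟨d, hd⟩‖
        rw [zero_mul] at this
        exact this.mono_left nhdsWithin_le_nhds
      refine squeeze_zero_norm' ?_ hlim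
      filter_upwards [self_mem_nhdsWithin] with t (ht : 0 < t)
      exact hT1 t ht.le ⟨d, hd⟩
  have hgen : ∀ x : A.domain, Tendsto (fun t : ℝ => t⁻¹ • (T t x - x)) (𝓝[>] 0) (𝓝 (A x)) := by
    intro x
    rw [Metric.tendsto_nhds]
    intro ε hε
    obtain ⟨l, hl, hl0⟩ := ((Metric.tendsto_nhds.1 (tendsto_smul_resolvent hA hR hRn (A x))
      (ε / 4) (by positivity)).and (eventually_gt_atTop (0 : ℝ))).exists
    -- approximate `x` by `w = l R x ∈ dom A²`
    obtain ⟨hx', -⟩ := (hR l hl0).right_inv x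
    obtain ⟨hAx', -⟩ := (hR l hl0).right_inv (A x)
    have hw : (l : ℂ) • R l x ∈ A.domain := A.domain.smul_mem _ hx'
    have hAw : A ⟨(l : ℂ) • R l x, hw⟩ = (l : ℂ) • R l (A x) := by
      have h1 := (hR l hl0).left_inv x
      obtain ⟨hz, hz'⟩ := (hR l hl0).right_inv x
      have h2 : A ⟨R l x, hz⟩ = R l (A x) := by
        rw [map_sub, map_smul] at h1
        rw [← sub_eq_iff_eq_add'.2 (sub_eq_iff_eq_add.1 hz'), ← sub_eq_iff_eq_add'.2
          (sub_eq_iff_eq_add.1 h1)]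
      rw [← h2, ← A.map_smul]
      rfl
    generalize (l : ℂ) • R l x = w at hw hAw
    have hAAw : A ⟨w, hw⟩ ∈ A.domain := hAw ▸ A.domain.smul_mem _ hAx'
    rw [← hAw, dist_eq_norm] at hl
    have hsmall : ∀ᶠ t : ℝ in 𝓝[>] 0, t * ‖A ⟨A ⟨w, hw⟩, hAAw⟩‖ < ε / 4 := by
      have := (tendsto_id (α := ℝ) (x := 𝓝 0)).mul_const ‖A ⟨A ⟨w, hw⟩, hAAw⟩‖
      rw [zero_mul] at this
      exact (this.mono_left nhdsWithin_le_nhds).eventually (gt_mem_nhds (by positivity))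
    filter_upwards [hsmall, self_mem_nhdsWithin] with t hts (ht : 0 < t)
    have e1 := hT1 t ht.le (x - ⟨w, hw⟩)
    have e2 := hT2 t ht.le ⟨w, hw⟩ hAAw
    rw [A.map_sub, norm_sub_rev (A x)] at e1
    simp only [Submodule.coe_sub] at e1
    have hdec : t⁻¹ • (T t x - x) - A x = t⁻¹ • (T t (x - w) - (x - w)) +
        t⁻¹ • (T t w - w - t • A ⟨w, hw⟩) + (A ⟨w, hw⟩ - A x) := by
      rw [smul_sub t⁻¹ (T t w - w), smul_smul, inv_mul_cancel₀ ht.ne', one_smul, map_sub]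
      module
    have b1 : ‖t⁻¹ • (T t (x - w) - (x - w))‖ ≤ ‖A ⟨w, hw⟩ - A x‖ := by
      rw [norm_smul, Real.norm_of_nonneg (by positivity), inv_mul_le_iff₀ ht]
      exact e1
    have b2 : ‖t⁻¹ • (T t w - w - t • A ⟨w, hw⟩)‖ ≤ t * ‖A ⟨A ⟨w, hw⟩, hAAw⟩‖ := by
      rw [norm_smul, Real.norm_of_nonneg (by positivity), inv_mul_le_iff₀ ht, ← mul_assoc, ← sq]
      exact e2
    rw [dist_eq_norm, hdec]
    refine (norm_add₃_le).trans_lt ?_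
    linarith
  refine ⟨T, ⟨?_, ?_, hcont⟩, ?_, hTn⟩
  · ext x
    refine tendsto_nhds_unique (hT 0 le_rfl x) ?_
    simp
  · intro s t hs ht
    ext x
    refine tendsto_nhds_unique (hT (s + t) (add_nonneg hs ht) x) ?_
    have h1 := hT t ht x
    have h2 := hT s hs (T t x)
    have h3 : Tendsto (fun l => NormedSpace.exp (s • yosidaApprox R l)
        (NormedSpace.exp (t • yosidaApprox R l) x - T t x)) atTop (𝓝 0) := by
      refine squeeze_zero_norm' ?_ (by simpa using (h1.sub_const (T t x)).norm)
      filter_upwards [eventually_gt_atTop 0] with l hl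
      exact (hc l hl).norm_apply_le hs _
    have h4 := h3.add h2
    rw [zero_add] at h4
    refine h4.congr fun l => ?_
    let : NormedAlgebra ℚ (X →L[ℂ] X) := NormedAlgebra.restrictScalars ℚ ℝ _
    rw [add_smul, NormedSpace.exp_add_of_commute
      (((Commute.refl _).smul_left s).smul_right t), mul_apply_eq_comp, map_sub, sub_add_cancel]
  · intro x z
    constructor
    · intro hxz
      obtain ⟨x', rfl, rfl⟩ := (LinearPMap.mem_graph_iff _).1 hxz
      exact hgen x'
    · intro hxz
      obtain ⟨hw, hw'⟩ := (hR 1 one_pos).right_inv (x - z)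
      generalize R 1 (x - z) = w at hw hw'
      have h1 := hxz.sub (hgen ⟨w, hw⟩)
      have h2 : z - A ⟨w, hw⟩ = x - w := by
        rw [Complex.ofReal_one, one_smul, sub_eq_sub_iff_add_eq_add] at hw'
        rw [sub_eq_sub_iff_add_eq_add, add_comm, hw']
      have h3 : x - w = 0 := by
        refine eq_zero_of_tendsto_of_contraction hTn ?_
        rw [h2] at h1
        refine h1.congr fun t => ?_
        rw [map_sub]
        module
      rw [h3] at h2
      rw [sub_eq_zero.1 h3, sub_eq_zero.1 h2]
      exact A.mem_graph ⟨w, hw⟩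

end HilleYosida

/-! ### Maximal dissipative operators in Hilbert spaces -/

section Dissipative

variable {E : Type*} [NormedAddCommGroup E] [InnerProductSpace ℂ E]

/-- Dissipative operators: `Re ⟨A x, x⟩ ≤ 0`. -/
def DissipativeOp (A : E →ₗ.[ℂ] E) : Prop := ∀ x : A.domain, (inner ℂ (x : E) (A x)).re ≤ 0

theorem DissipativeOp.re_mul_norm_le {A : E →ₗ.[ℂ] E} (hA : DissipativeOp A) (s : ℂ)
    (x : A.domain) : s.re * ‖(x : E)‖ ≤ ‖s • (x : E) - A x‖ := by
  have h1 : s.re * ‖(x : E)‖ ^ 2 ≤ (inner ℂ (x : E) (s • (x : E) - A x)).re := by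
    rw [inner_sub_right, inner_smul_right, inner_self_eq_norm_sq_to_K]
    have : (s * ((‖(x : E)‖ : ℂ)) ^ 2).re = s.re * ‖(x : E)‖ ^ 2 := by
      rw [← Complex.ofReal_pow, Complex.re_mul_ofReal]
    have h2 := hA x
    simp only [Complex.sub_re, Complex.coe_algebraMap, this]
    linarith
  have h2 : (inner ℂ (x : E) (s • (x : E) - A x)).re ≤ ‖(x : E)‖ * ‖s • (x : E) - A x‖ :=
    (Complex.re_le_norm _).trans (norm_inner_le_norm _ _)
  rcases eq_or_ne (‖(x : E)‖) 0 with h0 | h0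
  · rw [h0, mul_zero]; exact norm_nonneg _
  · have hpos : 0 < ‖(x : E)‖ := lt_of_le_of_ne (norm_nonneg _) h0.symm
    refine le_of_mul_le_mul_left ?_ hpos
    linarith [h1.trans h2]

theorem DissipativeOp.exists_resolvent {A : E →ₗ.[ℂ] E} (hA : DissipativeOp A) {s : ℂ}
    (hs : 0 < s.re) (hsurj : ∀ z, ∃ x : A.domain, s • (x : E) - A x = z) :
    ∃ R : E →L[ℂ] E, IsResolventAt A s R ∧ ‖R‖ ≤ s.re⁻¹ := by
  let L : A.domain →ₗ[ℂ] E := s • A.domain.subtype - A.toFun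
  have hL : ∀ x : A.domain, L x = s • (x : E) - A x := fun _ => rfl
  have hinj : Function.Injective L := by
    refine (injective_iff_map_eq_zero L).2 fun x hx => ?_
    have := hA.re_mul_norm_le s x
    rw [← hL, hx, norm_zero] at this
    have h0 : ‖(x : E)‖ ≤ 0 := by
      by_contra hcon
      push Not at hcon
      exact absurd this (not_le.2 (mul_pos hs hcon))
    exact Subtype.ext (norm_le_zero_iff.1 h0)
  let e := LinearEquiv.ofBijective L ⟨hinj, hsurj⟩
  have he : ∀ z, L (e.symm z) = z := fun z => e.apply_symm_apply z
  let R : E →L[ℂ] E := (A.domain.subtype.comp e.symm.toLinearMap).mkContinuous s.re⁻¹ (by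
    intro z
    have := hA.re_mul_norm_le s (e.symm z)
    rw [← hL, he] at this
    rw [le_inv_mul_iff₀ hs]
    exact this)
  refine ⟨R, ⟨fun x => ?_, fun z => ⟨(e.symm z).2, he z⟩⟩,
    LinearMap.mkContinuous_norm_le _ (inv_nonneg.2 hs.le) _⟩
  have : e.symm (s • (x : E) - A x) = x := e.symm_apply_apply x
  exact congrArg Subtype.val this

variable [CompleteSpace E]

theorem DissipativeOp.surjective_of_denseRange {A : E →ₗ.[ℂ] E} (hA : DissipativeOp A)
    (hc : A.IsClosed) {s : ℂ} (hs : 0 < s.re)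
    (hd : DenseRange fun x : A.domain => s • (x : E) - A x) (z : E) :
    ∃ x : A.domain, s • (x : E) - A x = z := by
  obtain ⟨v, hv, hvz⟩ := mem_closure_iff_seq_limit.1 (hd z)
  choose w hw using hv
  have hcau : CauchySeq fun n => (w n : E) := by
    rw [Metric.cauchySeq_iff]
    intro ε hε
    obtain ⟨N, hN⟩ := Metric.cauchySeq_iff.1 hvz.cauchySeq (s.re * ε) (mul_pos hs hε)
    refine ⟨N, fun m hm n hn => ?_⟩
    have h1 := hA.re_mul_norm_le s (w m - w n)
    have h2 : s • ((w m - w n : A.domain) : E) - A (w m - w n) = v m - v n := by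
      rw [A.map_sub, ← hw, ← hw, Submodule.coe_sub, smul_sub]
      simp only
      abel
    rw [h2, ← dist_eq_norm] at h1
    rw [dist_eq_norm]
    exact lt_of_mul_lt_mul_left (h1.trans_lt (hN m hm n hn)) hs.le
  obtain ⟨x, hx⟩ := cauchySeq_tendsto_of_complete hcau
  have hAw : Tendsto (fun n => A (w n)) atTop (𝓝 (s • x - z)) := by
    refine ((hx.const_smul s).sub hvz).congr fun n => ?_
    rw [← hw]
    simp only
    abel
  have hmem : (x, s • x - z) ∈ A.graph :=
    hc.mem_of_tendsto (hx.prodMk_nhds hAw) (Eventually.of_forall fun n => A.mem_graph (w n))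
  obtain ⟨x', hx', hx''⟩ := (LinearPMap.mem_graph_iff _).1 hmem
  refine ⟨x', ?_⟩
  simp only at hx' hx''
  rw [hx'', hx']
  abel

theorem IsResolventAt.exists_of_norm_lt {A : E →ₗ.[ℂ] E} {s : ℂ} {R : E →L[ℂ] E}
    (hR : IsResolventAt A s R) {r : ℂ} (h : ‖(s - r) • R‖ < 1) (z : E) :
    ∃ x : A.domain, r • (x : E) - A x = z := by
  let N := Units.oneSub ((s - r) • R) h
  obtain ⟨hx, hx'⟩ := hR.right_inv ((↑N⁻¹ : E →L[ℂ] E) z)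
  refine ⟨⟨_, hx⟩, ?_⟩
  have h1 : (N : E →L[ℂ] E) ((↑N⁻¹ : E →L[ℂ] E) z) = z := by
    rw [← mul_apply_eq_comp, Units.mul_inv, one_apply_eq_self]
  have h2 : ∀ y, (N : E →L[ℂ] E) y = y - (s - r) • R y := fun y => rfl
  rw [h2] at h1
  generalize (↑N⁻¹ : E →L[ℂ] E) z = y at *
  calc r • R y - A ⟨R y, hx⟩ = (s • R y - A ⟨R y, hx⟩) - (s - r) • R y := by
        rw [sub_smul]; abel
    _ = z := by rw [hx', h1]

theorem DissipativeOp.surjective_of_re_pos {A : E →ₗ.[ℂ] E} (hA : DissipativeOp A)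
    (hc : A.IsClosed) {l : ℂ} (hl : 0 < l.re)
    (hd : DenseRange fun x : A.domain => l • (x : E) - A x) {s : ℂ} (hs : 0 < s.re) (z : E) :
    ∃ x : A.domain, s • (x : E) - A x = z := by
  let V : Set ℂ := {r | 0 < r.re ∧ ∀ z, ∃ x : A.domain, r • (x : E) - A x = z}
  have hnear : ∀ r ∈ V, ∀ q : ℂ, 0 < q.re → ‖r - q‖ < r.re → q ∈ V := by
    intro r hr q hq hrq
    refine ⟨hq, ?_⟩
    obtain ⟨R, hR, hRn⟩ := hA.exists_resolvent hr.1 hr.2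
    refine hR.exists_of_norm_lt ?_
    rw [norm_smul]
    calc ‖r - q‖ * ‖R‖ ≤ ‖r - q‖ * r.re⁻¹ := by gcongr
      _ < r.re * r.re⁻¹ := by gcongr; exact inv_pos.2 hr.1
      _ = 1 := mul_inv_cancel₀ hr.1.ne'
  have hopen : IsOpen V := by
    rw [Metric.isOpen_iff]
    intro r hr
    refine ⟨r.re, hr.1, fun q hq => hnear r hr q ?_ ?_⟩
    · rw [Metric.mem_ball, dist_comm, dist_eq_norm] at hq
      have := (Complex.re_le_norm (r - q)).trans_lt hq
      rw [Complex.sub_re] at this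
      linarith
    · rwa [Metric.mem_ball, dist_comm, dist_eq_norm] at hq
  have hpre : IsPreconnected {r : ℂ | 0 < r.re} := (convex_halfSpace_re_gt 0).isPreconnected
  have hsub : {r : ℂ | 0 < r.re} ⊆ V := by
    refine hpre.subset_of_closure_inter_subset hopen
      ⟨l, hl, hl, hA.surjective_of_denseRange hc hl hd⟩ ?_
    rintro q ⟨hq, hq0 : 0 < q.re⟩
    obtain ⟨r, hr, hrq⟩ := Metric.mem_closure_iff.1 hq (q.re / 2) (half_pos hq0)
    rw [dist_eq_norm] at hrq
    have h1 := (Complex.re_le_norm (q - r)).trans_lt hrq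
    rw [Complex.sub_re] at h1
    refine hnear r hr q hq0 ?_
    rw [norm_sub_rev]
    linarith
  exact (hsub hs).2 z

theorem DissipativeOp.dense_domain {A : E →ₗ.[ℂ] E} (hA : DissipativeOp A) {s : ℂ}
    (hs : 0 < s.re) (hsurj : ∀ z, ∃ x : A.domain, s • (x : E) - A x = z) :
    Dense (A.domain : Set E) := by
  rw [Submodule.dense_iff_topologicalClosure_eq_top, Submodule.topologicalClosure_eq_top_iff,
    Submodule.eq_bot_iff]
  intro z hz
  obtain ⟨x, rfl⟩ := hsurj z
  have h0 := (Submodule.mem_orthogonal _ _).1 hz x x.2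
  rw [inner_sub_right, inner_smul_right, inner_self_eq_norm_sq_to_K, sub_eq_zero] at h0
  have h1 := hA x
  have h2 : (s * ((‖(x : E)‖ : ℂ)) ^ 2).re = s.re * ‖(x : E)‖ ^ 2 := by
    rw [← Complex.ofReal_pow, Complex.re_mul_ofReal]
  rw [← h0] at h1
  have h2 : ‖(x : E)‖ ^ 2 ≤ 0 := nonpos_of_mul_nonpos_right (h2.symm.trans_le h1) hs
  have h3 : x = 0 := by
    refine Subtype.ext (norm_eq_zero.1 ?_)
    nlinarith [norm_nonneg (x : E)]
  rw [h3]
  simp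

/-- The Lumer–Phillips theorem in Hilbert spaces. -/
theorem DissipativeOp.generatesContractionSemigroup {A : E →ₗ.[ℂ] E} (hA : DissipativeOp A)
    (hsurj : ∀ s : ℂ, 0 < s.re → ∀ z, ∃ x : A.domain, s • (x : E) - A x = z) :
    GeneratesContractionSemigroup A := by
  have hex : ∀ l : ℝ, ∃ R : E →L[ℂ] E, 0 < l → IsResolventAt A (l : ℂ) R ∧ ‖R‖ ≤ l⁻¹ := by
    intro l
    by_cases hl : 0 < l
    · obtain ⟨R, hR⟩ := hA.exists_resolvent (s := l) (by simpa using hl) (hsurj l (by simpa using hl))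
      exact ⟨R, fun _ => by simpa using hR⟩
    · exact ⟨0, fun h => absurd h hl⟩
  choose R hR using hex
  exact generatesContractionSemigroup_of_resolvent_bound
    (hA.dense_domain (s := 1) (by simp) (hsurj 1 (by simp)))
    (fun l hl => (hR l hl).1) (fun l hl => (hR l hl).2)

end Dissipative

/-! ### Graphs of rows, main operators and compositions -/

section Graphs

variable {E F G X U Y : Type*} [AddCommGroup E] [Module ℂ E] [AddCommGroup F] [Module ℂ F]
  [AddCommGroup G] [Module ℂ G] [AddCommGroup X] [Module ℂ X]
  [AddCommGroup U] [Module ℂ U] [AddCommGroup Y] [Module ℂ Y]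

theorem mem_graph_precompPMap {f : F →ₗ.[ℂ] G} {T : E →ₗ[ℂ] F} {x : E} {z : G} :
    (x, z) ∈ (precompPMap f T).graph ↔ (T x, z) ∈ f.graph := by
  simp only [LinearPMap.mem_graph_iff]
  constructor
  · rintro ⟨⟨x', hx'⟩, rfl, rfl⟩
    exact ⟨⟨T x', hx'⟩, rfl, rfl⟩
  · rintro ⟨⟨w, hw⟩, h1, rfl⟩
    simp only at h1
    subst h1
    exact ⟨⟨x, hw⟩, rfl, rfl⟩

theorem mem_graph_compPMap {f : E →ₗ.[ℂ] F} {T : F →ₗ[ℂ] G} {x : E} {z : G} :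
    (x, z) ∈ (T.compPMap f).graph ↔ ∃ w, (x, w) ∈ f.graph ∧ T w = z := by
  simp only [LinearPMap.mem_graph_iff]
  constructor
  · rintro ⟨x', rfl, rfl⟩
    exact ⟨f x', ⟨x', rfl, rfl⟩, rfl⟩
  · rintro ⟨w, ⟨x', rfl, rfl⟩, rfl⟩
    exact ⟨x', rfl, rfl⟩

theorem mem_graph_upperRow {S : (E × U) →ₗ.[ℂ] (X × Y)} {p : E × U} {z : X} :
    (p, z) ∈ (upperRow S).graph ↔ ∃ y, (p, (z, y)) ∈ S.graph := by
  rw [upperRow, mem_graph_compPMap]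
  constructor
  · rintro ⟨⟨w, y⟩, hw, rfl⟩
    exact ⟨y, hw⟩
  · rintro ⟨y, hy⟩
    exact ⟨(z, y), hy, rfl⟩

theorem mem_graph_lowerRow {S : (E × U) →ₗ.[ℂ] (X × Y)} {p : E × U} {y : Y} :
    (p, y) ∈ (lowerRow S).graph ↔ ∃ z, (p, (z, y)) ∈ S.graph := by
  rw [lowerRow, mem_graph_compPMap]
  constructor
  · rintro ⟨⟨z, w⟩, hw, rfl⟩
    exact ⟨z, hw⟩
  · rintro ⟨z, hz⟩
    exact ⟨(z, y), hz, rfl⟩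

theorem mem_graph_mainOperator {S : (E × U) →ₗ.[ℂ] (X × Y)} {x : E} {z : X} :
    (x, z) ∈ (mainOperator S).graph ↔ ∃ y, ((x, 0), (z, y)) ∈ S.graph := by
  rw [mainOperator, mem_graph_precompPMap, mem_graph_upperRow]
  rfl

theorem LinearPMap.apply_eq_of_mem_graph {f : E →ₗ.[ℂ] F} {x : E} {z : F} (h : (x, z) ∈ f.graph)
    (hx : x ∈ f.domain) : f ⟨x, hx⟩ = z :=
  f.mem_graph_snd_inj (f.mem_graph ⟨x, hx⟩) h rfl

end Graphs

/-! ### The transfer function of an operator node -/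

section TransferFunction

variable {X U Y : Type*} [NormedAddCommGroup X] [NormedSpace ℂ X]
  [NormedAddCommGroup U] [NormedSpace ℂ U] [NormedAddCommGroup Y] [NormedSpace ℂ Y]

theorem IsResolventAt.eq_zero_of_mem_graph {A : X →ₗ.[ℂ] X} {s : ℂ} {R : X →L[ℂ] X}
    (hR : IsResolventAt A s R) {x : X} (hx : (x, s • x) ∈ A.graph) : x = 0 := by
  obtain ⟨x', rfl, h2⟩ := (LinearPMap.mem_graph_iff _).1 hx
  have := hR.left_inv x'
  rw [h2] at this
  simpa using this.symm

/-- The pair `((s I - A)⁻¹ B u, G(s) u)` is determined by `u`. -/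
theorem IsResolventAt.eq_of_mem_graph {S : (X × U) →ₗ.[ℂ] (X × Y)} {s : ℂ} {R : X →L[ℂ] X}
    (hR : IsResolventAt (mainOperator S) s R) {u : U} {x x' : X} {y y' : Y}
    (h : ((x, u), (s • x, y)) ∈ S.graph) (h' : ((x', u), (s • x', y')) ∈ S.graph) :
    x = x' ∧ y = y' := by
  have hd := S.graph.sub_mem h h'
  simp only [Prod.mk_sub_mk, sub_self, ← smul_sub] at hd
  have h0 : x - x' = 0 := hR.eq_zero_of_mem_graph (mem_graph_mainOperator.2 ⟨_, hd⟩)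
  have hx := sub_eq_zero.1 h0
  subst hx
  exact ⟨rfl, (Prod.ext_iff.1 (S.mem_graph_snd_inj h h' rfl)).2⟩

theorem IsResolventAt.exists_mem_graph {S : (X × U) →ₗ.[ℂ] (X × Y)} {s : ℂ} {R : X →L[ℂ] X}
    (hR : IsResolventAt (mainOperator S) s R) {u : U} (hu : ∃ x : X, (x, u) ∈ S.domain) :
    ∃ w : X × Y, ((w.1, u), (s • w.1, w.2)) ∈ S.graph := by
  obtain ⟨x, hx⟩ := hu
  obtain ⟨⟨z, y⟩, hzy⟩ := LinearPMap.mem_domain_iff.1 hx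
  obtain ⟨hd, hd'⟩ := hR.right_inv (z - s • x)
  obtain ⟨y', hy'⟩ := mem_graph_mainOperator.1 ((mainOperator S).mem_graph ⟨_, hd⟩)
  have h := S.graph.add_mem hzy hy'
  refine ⟨(x + R (z - s • x), y + y'), ?_⟩
  have e : z + mainOperator S ⟨_, hd⟩ = s • (x + R (z - s • x)) := by
    rw [smul_add, ← sub_eq_iff_eq_add'.2 (sub_eq_iff_eq_add.1 hd')]
    abel
  simp only [Prod.mk_add_mk, add_zero, e] at h
  exact h

variable [CompleteSpace X] [CompleteSpace U] [CompleteSpace Y]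

/-- The bounded operator `u ↦ ((s I - A)⁻¹ B u, G(s) u)`. -/
theorem IsResolventAt.exists_input_map {S : (X × U) →ₗ.[ℂ] (X × Y)} (hS : S.IsClosed)
    (hu : ∀ u : U, ∃ x : X, (x, u) ∈ S.domain) {s : ℂ} {R : X →L[ℂ] X}
    (hR : IsResolventAt (mainOperator S) s R) :
    ∃ W : U →L[ℂ] X × Y, ∀ u, (((W u).1, u), (s • (W u).1, (W u).2)) ∈ S.graph := by
  choose w hw using fun u => hR.exists_mem_graph (hu u)
  have huniq : ∀ u (v : X × Y), ((v.1, u), (s • v.1, v.2)) ∈ S.graph → v = w u := fun u v hv =>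
    Prod.ext_iff.2 (hR.eq_of_mem_graph hv (hw u))
  let L : U →ₗ[ℂ] X × Y :=
    { toFun := w
      map_add' := fun u v => (huniq _ _ (by
        have := S.graph.add_mem (hw u) (hw v)
        simp only [Prod.mk_add_mk, ← smul_add] at this
        exact this)).symm
      map_smul' := fun c u => (huniq _ _ (by
        have := S.graph.smul_mem c (hw u)
        rw [Prod.smul_mk, Prod.smul_mk, Prod.smul_mk, smul_comm c s] at this
        exact this)).symm }
  refine ⟨⟨L, L.continuous_of_seq_closed_graph fun v u z hv hz => huniq u z ?_⟩, hw⟩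
  have h1 : Tendsto (fun n => (w (v n)).1) atTop (𝓝 z.1) := (continuous_fst.tendsto z).comp hz
  have h2 : Tendsto (fun n => (w (v n)).2) atTop (𝓝 z.2) := (continuous_snd.tendsto z).comp hz
  exact hS.mem_of_tendsto ((h1.prodMk_nhds hv).prodMk_nhds ((h1.const_smul s).prodMk_nhds h2))
    (Eventually.of_forall fun n => hw (v n))

end TransferFunction

section ExtrapolationMaps

variable {X : Type*} [NormedAddCommGroup X] [NormedSpace ℂ X]

/-- The embedding of `X` into `X_{-1}` as a bounded operator. -/
def toExtrapolationL (A : X →ₗ.[ℂ] X) (α : resolventSetOf A) : X →L[ℂ] ExtrapolationSpace A α :=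
  LinearMap.mkContinuous
    { toFun := toExtrapolation A α
      map_add' := fun x y => UniformSpace.Completion.coe_add (α := PreExtrapolation A α) x y
      map_smul' := fun c x => UniformSpace.Completion.coe_smul (X := PreExtrapolation A α) c x }
    ‖resolventOf A α‖ fun x => by
      have := (resolventOf A α).le_opNorm x
      rwa [← norm_toExtrapolation] at this

theorem toExtrapolationL_apply (A : X →ₗ.[ℂ] X) (α : resolventSetOf A) (x : X) :
    toExtrapolationL A α x = toExtrapolation A α x := rfl

theorem toExtrapolation_injective (A : X →ₗ.[ℂ] X) (α : resolventSetOf A) :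
    Function.Injective (toExtrapolation A α) :=
  UniformSpace.Completion.coe_injective (PreExtrapolation A α)

/-- A densely defined operator with nonempty resolvent set extends to a bounded operator
`A_{-1} : X → X_{-1}`. -/
theorem exists_extrapolated_operator {A : X →ₗ.[ℂ] X} (hA : Dense (A.domain : Set X))
    (α : resolventSetOf A) : ∃ A₁ : X →L[ℂ] ExtrapolationSpace A α,
      ∀ x : A.domain, A₁ x = toExtrapolation A α (A x) := by
  have hbound : ∀ x : A.domain, ‖((toExtrapolationL A α).toLinearMap.comp A.toFun) x‖ ≤
      (‖(α : ℂ) • resolventOf A α‖ + 1) * ‖A.domain.subtype x‖ := by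
    intro x
    have h := (resolventOf_spec A α).left_inv x
    rw [map_sub, map_smul] at h
    change ‖toExtrapolation A α (A x)‖ ≤ _
    rw [norm_toExtrapolation]
    have e : resolventOf A α (A x) = ((α : ℂ) • resolventOf A α) x - x := by
      rw [smul_apply, sub_eq_iff_eq_add.1 h]; abel
    rw [e, add_mul, one_mul]
    exact (norm_sub_le _ _).trans
      (add_le_add (ContinuousLinearMap.le_opNorm _ _) le_rfl)
  have hd : DenseRange A.domain.subtype := by
    simpa [DenseRange] using hA
  exact ⟨((toExtrapolationL A α).toLinearMap.comp A.toFun).extendOfNorm A.domain.subtype,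
    fun x => LinearMap.extendOfNorm_eq hd ⟨_, hbound⟩ x⟩

end ExtrapolationMaps

section ExistsTransfer

variable {X U Y : Type*} [NormedAddCommGroup X] [NormedSpace ℂ X]
  [NormedAddCommGroup U] [NormedSpace ℂ U] [NormedAddCommGroup Y] [NormedSpace ℂ Y]

theorem IsTransferFunction.exists_mem_graph {S : (X × U) →ₗ.[ℂ] (X × Y)}
    {G : resolventSetOf (mainOperator S) → U →L[ℂ] Y} (hG : IsTransferFunction S G)
    (s : resolventSetOf (mainOperator S)) (u : U) :
    ∃ x : X, ((x, u), ((s : ℂ) • x, G s u)) ∈ S.graph := by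
  obtain ⟨A₁, B, h1, h2⟩ := hG s
  obtain ⟨x, hx, hx1, hx2⟩ := h2 s u
  refine ⟨x, ?_⟩
  have hS : (x, u) ∈ S.domain := hx
  have h3 : A₁ x + B u = toExtrapolation (mainOperator S) s (S ⟨(x, u), hS⟩).1 :=
    h1 ⟨(x, u), hx⟩
  rw [← hx1, add_sub_cancel, ← toExtrapolationL_apply, ← map_smul] at h3
  have h4 := toExtrapolation_injective _ _ h3
  have h5 : G s u = (S ⟨(x, u), hS⟩).2 := hx2
  rw [h4, h5]
  exact S.mem_graph ⟨(x, u), hS⟩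

variable [CompleteSpace X] [CompleteSpace U] [CompleteSpace Y]

/-- An operator node has exactly one transfer function. -/
theorem IsOperatorNode.existsUnique_transferFunction {S : (X × U) →ₗ.[ℂ] (X × Y)}
    (hS : IsOperatorNode S) :
    ∃! G : resolventSetOf (mainOperator S) → U →L[ℂ] Y, IsTransferFunction S G := by
  choose W hW using fun s : resolventSetOf (mainOperator S) =>
    (resolventOf_spec _ s).exists_input_map hS.closed hS.exists_state
  refine ⟨fun s => (ContinuousLinearMap.snd ℂ X Y).comp (W s), ?_, ?_⟩
  · intro α
    obtain ⟨A₁, hA₁⟩ := exists_extrapolated_operator hS.dense_domain α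
    let Φ : U →L[ℂ] X := (ContinuousLinearMap.fst ℂ X Y).comp (W α)
    have hext : ∀ (x : X) (u : U) (z : X) (y : Y), ((x, u), (z, y)) ∈ S.graph →
        A₁ x + (((α : ℂ) • toExtrapolationL (mainOperator S) α - A₁).comp Φ) u =
          toExtrapolation (mainOperator S) α z := by
      intro x u z y h
      have hd := S.graph.sub_mem h (hW α u)
      simp only [Prod.mk_sub_mk, sub_self] at hd
      obtain ⟨d, hd1, hd2⟩ :=
        (LinearPMap.mem_graph_iff _).1 (mem_graph_mainOperator.2 ⟨_, hd⟩)
      have h1 := hA₁ d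
      simp only at hd1 hd2
      rw [hd1, hd2, ← toExtrapolationL_apply, map_sub, map_sub, map_smul] at h1
      have h2 : A₁ x = toExtrapolationL (mainOperator S) α z -
          (α : ℂ) • toExtrapolationL (mainOperator S) α (W α u).1 + A₁ (W α u).1 :=
        sub_eq_iff_eq_add.1 h1
      change A₁ x + ((α : ℂ) • toExtrapolationL (mainOperator S) α (W α u).1 - A₁ (W α u).1) =
        toExtrapolationL (mainOperator S) α z
      rw [h2]
      abel
    refine ⟨A₁, _, fun z => hext _ _ _ _ (S.mem_graph z), fun s u => ?_⟩
    have hg := hW s u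
    have hx := LinearPMap.mem_domain_of_mem_graph hg
    refine ⟨(W s u).1, hx, ?_, ?_⟩
    · have := hext _ _ _ _ hg
      rw [← toExtrapolationL_apply, map_smul] at this
      exact sub_eq_iff_eq_add'.2 this.symm
    · exact (LinearPMap.apply_eq_of_mem_graph (mem_graph_lowerRow.2 ⟨_, hg⟩) hx).symm
  · intro G hG
    funext s
    ext u
    obtain ⟨x, hx⟩ := hG.exists_mem_graph s u
    exact ((resolventOf_spec _ s).eq_of_mem_graph hx (hW s u)).2

end ExistsTransfer

/-! ### The port-Hamiltonian node -/

section PortHamiltonian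

variable {E U : Type*} [NormedAddCommGroup E] [InnerProductSpace ℂ E]
  [NormedAddCommGroup U] [InnerProductSpace ℂ U]

/-- `S = diag(I, -I) M diag(R, I)`, where `R` is the Riesz map. -/
def IsRieszRealization (S : (E × U) →ₗ.[ℂ] (E × AntiDual U))
    (M : (AntiDual E × U) →ₗ.[ℂ] (E × AntiDual U)) : Prop :=
  ∀ x u z y, ((x, u), (z, y)) ∈ S.graph ↔ ((rieszMap E x, u), (z, -y)) ∈ M.graph

theorem ClosedPositiveForm.energeticExtension_eq_rieszMap {X : Type*} [NormedAddCommGroup X]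
    [InnerProductSpace ℂ X] [CompleteSpace X] (h : ClosedPositiveForm X) :
    h.energeticExtension = rieszMap h.EnergeticSpace := by
  refine h.existsUnique_energeticExtension.unique h.energeticExtension_spec ?_
  intro x f hxf y
  rw [h.graph_operator] at hxf
  obtain ⟨hx, hf⟩ := hxf
  rw [rieszMap_apply, h.inner_toEnergetic]
  exact hf y

theorem isRieszRealization_portHamiltonianNode {X : Type*} [NormedAddCommGroup X]
    [InnerProductSpace ℂ X] [CompleteSpace X] (h : ClosedPositiveForm X)
    (M : (AntiDual h.EnergeticSpace × U) →ₗ.[ℂ] (h.EnergeticSpace × AntiDual U)) :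
    IsRieszRealization (portHamiltonianNode h M) M := by
  intro x u z y
  rw [portHamiltonianNode, mem_graph_compPMap, h.energeticExtension_eq_rieszMap]
  constructor
  · rintro ⟨⟨w1, w2⟩, hw, hw'⟩
    rw [mem_graph_precompPMap] at hw
    obtain ⟨h1, h2⟩ := Prod.ext_iff.1 hw'
    simp only [LinearMap.prodMap_apply, LinearMap.id_apply, LinearMap.neg_apply] at h1 h2
    rw [← h1, ← h2, neg_neg]
    exact hw
  · intro hw
    refine ⟨(z, -y), mem_graph_precompPMap.2 hw, ?_⟩
    simp

theorem powerOf_eq_of_mem_graph {M : (AntiDual E × U) →ₗ.[ℂ] (E × AntiDual U)} {x z : E} {u : U}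
    {w : AntiDual U} (h : ((rieszMap E x, u), (z, w)) ∈ M.graph) :
    powerOf M (rieszMap E x, u) = inner ℂ x z + w u := by
  have hd := LinearPMap.mem_domain_of_mem_graph h
  rw [powerOf, LinearPMap.evalZero, dif_pos hd, LinearPMap.apply_eq_of_mem_graph h hd, blockPairing,
    rieszMap_apply, inner_conj_symm]

theorem IsDissipationNode.re_le_of_mem_graph [CompleteSpace E]
    {M : (AntiDual E × U) →ₗ.[ℂ] (E × AntiDual U)}
    (hM : IsDissipationNode M) {x z : E} {u : U} {w : AntiDual U}
    (h : ((rieszMap E x, u), (z, w)) ∈ M.graph) : (inner ℂ x z + w u).re ≤ 0 := by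
  have hd := LinearPMap.mem_domain_of_mem_graph h
  have := hM.dissipative ⟨_, hd⟩
  rwa [LinearPMap.apply_eq_of_mem_graph h hd, blockPairing, rieszMap_apply,
    inner_conj_symm] at this

variable {S : (E × U) →ₗ.[ℂ] (E × AntiDual U)} {M : (AntiDual E × U) →ₗ.[ℂ] (E × AntiDual U)}

theorem IsRieszRealization.mainOperator_eq (hS : IsRieszRealization S M) :
    mainOperator S = precompPMap (mainOperator M) (rieszMap E).toLinearMap := by
  refine LinearPMap.eq_of_eq_graph (Submodule.ext ?_)
  rintro ⟨x, z⟩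
  rw [mem_graph_precompPMap, mem_graph_mainOperator, mem_graph_mainOperator]
  constructor
  · rintro ⟨y, hy⟩
    exact ⟨-y, (hS _ _ _ _).1 hy⟩
  · rintro ⟨y, hy⟩
    refine ⟨-y, (hS _ _ _ _).2 ?_⟩
    rw [neg_neg]
    exact hy

theorem IsRieszRealization.isClosed (hS : IsRieszRealization S M) (hM : M.IsClosed) :
    S.IsClosed := by
  have hc : Continuous fun p : (E × U) × (E × AntiDual U) =>
      (((rieszMap E p.1.1, p.1.2), (p.2.1, -p.2.2)) :
        (AntiDual E × U) × (E × AntiDual U)) := by fun_prop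
  have he : (S.graph : Set ((E × U) × (E × AntiDual U))) = (fun p : (E × U) × (E × AntiDual U) =>
      (((rieszMap E p.1.1, p.1.2), (p.2.1, -p.2.2)) :
        (AntiDual E × U) × (E × AntiDual U))) ⁻¹' M.graph := by
    ext ⟨⟨x, u⟩, ⟨z, y⟩⟩
    exact hS x u z y
  rw [LinearPMap.IsClosed, he]
  exact IsClosed.preimage hc hM

theorem IsRieszRealization.mem_graph_upperRow_iff (hS : IsRieszRealization S M) (x : E) (u : U)
    (z : E) : ((x, u), z) ∈ (upperRow S).graph ↔ ((rieszMap E x, u), z) ∈ (upperRow M).graph := by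
  rw [mem_graph_upperRow, mem_graph_upperRow]
  constructor
  · rintro ⟨y, hy⟩
    exact ⟨-y, (hS _ _ _ _).1 hy⟩
  · rintro ⟨y, hy⟩
    refine ⟨-y, (hS _ _ _ _).2 ?_⟩
    rwa [neg_neg]

theorem IsRieszRealization.upperRow_isClosed (hS : IsRieszRealization S M)
    (hM : (upperRow M).IsClosed) : (upperRow S).IsClosed := by
  have hc : Continuous fun p : (E × U) × E =>
      (((rieszMap E p.1.1, p.1.2), p.2) : (AntiDual E × U) × E) := by fun_prop
  have he : ((upperRow S).graph : Set ((E × U) × E)) = (fun p : (E × U) × E =>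
      (((rieszMap E p.1.1, p.1.2), p.2) : (AntiDual E × U) × E)) ⁻¹' (upperRow M).graph := by
    ext ⟨⟨x, u⟩, z⟩
    exact hS.mem_graph_upperRow_iff x u z
  rw [LinearPMap.IsClosed, he]
  exact IsClosed.preimage hc hM

theorem isClosed_mainOperator (h : (upperRow S).IsClosed) : (mainOperator S).IsClosed := by
  have hc : Continuous fun p : E × E => (((p.1, 0), p.2) : (E × U) × E) := by fun_prop
  have he : ((mainOperator S).graph : Set (E × E)) =
      (fun p : E × E => (((p.1, 0), p.2) : (E × U) × E)) ⁻¹' (upperRow S).graph := by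
    ext ⟨x, z⟩
    exact mem_graph_precompPMap
  rw [LinearPMap.IsClosed, he]
  exact IsClosed.preimage hc h

variable [CompleteSpace E]

theorem IsRieszRealization.dissipativeOp (hS : IsRieszRealization S M)
    (hM : IsDissipationNode M) : DissipativeOp (mainOperator S) := by
  intro x
  obtain ⟨y, hy⟩ := mem_graph_mainOperator.1 ((mainOperator S).mem_graph x)
  have := hM.re_le_of_mem_graph ((hS _ _ _ _).1 hy)
  rwa [map_zero, add_zero] at this

theorem IsRieszRealization.surjective (hS : IsRieszRealization S M) (hM : IsDissipationNode M)
    (s : ℂ) (hs : 0 < s.re) (z : E) :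
    ∃ x : (mainOperator S).domain, s • (x : E) - mainOperator S x = z := by
  obtain ⟨l, hl, hd⟩ := hM.dense_range
  refine (hS.dissipativeOp hM).surjective_of_re_pos
    (isClosed_mainOperator (hS.upperRow_isClosed hM.upperRow_closed)) hl ?_ hs z
  refine Dense.mono ?_ hd
  rintro _ ⟨x', rfl⟩
  have hx : rieszMap E ((rieszEquiv E).symm (x' : AntiDual E)) = x' :=
    (rieszEquiv E).apply_symm_apply (x' : AntiDual E)
  have hg : ((rieszEquiv E).symm (x' : AntiDual E), mainOperator M x') ∈
      (mainOperator S).graph := by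
    rw [hS.mainOperator_eq, mem_graph_precompPMap]
    have := (mainOperator M).mem_graph x'
    rw [← hx] at this
    exact this
  have hdom := LinearPMap.mem_domain_of_mem_graph hg
  refine ⟨⟨_, hdom⟩, ?_⟩
  simp only
  rw [LinearPMap.apply_eq_of_mem_graph hg hdom]

theorem IsRieszRealization.mem_resolventSet (hS : IsRieszRealization S M)
    (hM : IsDissipationNode M) (s : ℂ) (hs : 0 < s.re) :
    s ∈ resolventSetOf (mainOperator S) := by
  obtain ⟨R, hR, -⟩ := (hS.dissipativeOp hM).exists_resolvent hs (hS.surjective hM s hs)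
  exact ⟨R, hR⟩

theorem IsRieszRealization.generatesContractionSemigroup (hS : IsRieszRealization S M)
    (hM : IsDissipationNode M) : GeneratesContractionSemigroup (mainOperator S) :=
  (hS.dissipativeOp hM).generatesContractionSemigroup (hS.surjective hM)

theorem IsRieszRealization.isSystemNode (hS : IsRieszRealization S M)
    (hM : IsDissipationNode M) : IsSystemNode S where
  closed := hS.isClosed hM.closed
  upperRow_closed := hS.upperRow_isClosed hM.upperRow_closed
  exists_state u := by
    obtain ⟨x', hx'⟩ := hM.exists_effort u
    obtain ⟨x, rfl⟩ := (rieszMap_bijective E).2 x'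
    obtain ⟨⟨z, y⟩, hzy⟩ := LinearPMap.mem_domain_iff.1 hx'
    refine ⟨x, LinearPMap.mem_domain_of_mem_graph (y := (z, -y)) ((hS _ _ _ _).2 ?_)⟩
    rwa [neg_neg]
  dense_domain := (hS.dissipativeOp hM).dense_domain (s := 1) (by simp)
    (hS.surjective hM 1 (by simp))
  resolventSet_nonempty := ⟨1, hS.mem_resolventSet hM 1 (by simp)⟩
  generates := by
    obtain ⟨T, h1, h2, -⟩ := hS.generatesContractionSemigroup hM
    exact ⟨T, h1, h2⟩

theorem IsRieszRealization.re_transferFunction_nonneg (hS : IsRieszRealization S M)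
    (hM : IsDissipationNode M) {G : resolventSetOf (mainOperator S) → U →L[ℂ] AntiDual U}
    (hG : IsTransferFunction S G) (s : resolventSetOf (mainOperator S)) (hs : 0 < (s : ℂ).re)
    (u : U) : 0 ≤ (G s u u).re := by
  obtain ⟨x, hx⟩ := hG.exists_mem_graph s u
  have h1 := hM.re_le_of_mem_graph ((hS _ _ _ _).1 hx)
  have h2 : (inner ℂ x ((s : ℂ) • x)).re = (s : ℂ).re * ‖x‖ ^ 2 := by
    have : (((s : ℂ)) * ((‖x‖ : ℂ)) ^ 2).re = (s : ℂ).re * ‖x‖ ^ 2 := by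
      rw [← Complex.ofReal_pow, Complex.re_mul_ofReal]
    rw [inner_smul_right, inner_self_eq_norm_sq_to_K]
    exact this
  rw [Complex.add_re, h2, neg_apply, Complex.neg_re] at h1
  have := mul_nonneg hs.le (sq_nonneg ‖x‖)
  linarith

end PortHamiltonian

/-! ### Energy balance along trajectories -/

section Pairing

variable {U : Type*} [NormedAddCommGroup U] [InnerProductSpace ℂ U]
  {Ω : Type*} [MeasurableSpace Ω] {μ : Measure Ω}

theorem continuous_antiDual_apply : Continuous fun p : AntiDual U × U => p.1 p.2 := by
  rw [continuous_iff_continuousAt]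
  intro p
  rw [ContinuousAt, tendsto_iff_norm_sub_tendsto_zero]
  have h1 : Tendsto (fun q : AntiDual U × U => ‖q.1 - p.1‖ * ‖q.2‖ + ‖p.1 (q.2 - p.2)‖) (𝓝 p)
      (𝓝 (‖p.1 - p.1‖ * ‖p.2‖ + ‖p.1 (p.2 - p.2)‖)) :=
    Continuous.tendsto (by fun_prop) p
  simp only [sub_self, norm_zero, zero_mul, map_zero, add_zero] at h1
  refine squeeze_zero (fun _ => norm_nonneg _) (fun q => ?_) h1
  have h2 : q.1 q.2 - p.1 p.2 = (q.1 - p.1) q.2 + p.1 (q.2 - p.2) := by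
    rw [sub_apply, map_sub]; ring
  rw [h2]
  exact (norm_add_le _ _).trans (add_le_add ((q.1 - p.1).le_opNorm q.2) le_rfl)

theorem AntiDual.aestronglyMeasurable_apply {y : Ω → AntiDual U} {u : Ω → U}
    (hy : AEStronglyMeasurable y μ) (hu : AEStronglyMeasurable u μ) :
    AEStronglyMeasurable (fun τ => y τ (u τ)) μ :=
  continuous_antiDual_apply.comp_aestronglyMeasurable (hy.prodMk hu)

theorem AntiDual.eLpNorm_apply_le {y : Ω → AntiDual U} {u : Ω → U}
    (hy : AEStronglyMeasurable y μ) (hu : AEStronglyMeasurable u μ) :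
    eLpNorm (fun τ => y τ (u τ)) 1 μ ≤ eLpNorm y 2 μ * eLpNorm u 2 μ := by
  have := eLpNorm_le_eLpNorm_mul_eLpNorm'_of_norm (p := 2) (q := 2) (r := 1) hy hu
    (fun a b => a b) 1 (Eventually.of_forall fun τ => by
      simpa using (y τ).le_opNorm (u τ))
  simpa using this

theorem AntiDual.integrable_apply {y : Ω → AntiDual U} {u : Ω → U} (hy : MemLp y 2 μ)
    (hu : MemLp u 2 μ) : Integrable (fun τ => y τ (u τ)) μ := by
  rw [← memLp_one_iff_integrable]
  exact ⟨AntiDual.aestronglyMeasurable_apply hy.1 hu.1,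
    (AntiDual.eLpNorm_apply_le hy.1 hu.1).trans_lt (ENNReal.mul_lt_top hy.2 hu.2)⟩

/-- The duality product is continuous from `L² × L²` to `L¹`. -/
theorem AntiDual.tendsto_integral_apply {yn : ℕ → Ω → AntiDual U} {un : ℕ → Ω → U}
    {y : Ω → AntiDual U} {u : Ω → U} (hyn : ∀ n, MemLp (yn n) 2 μ) (hun : ∀ n, MemLp (un n) 2 μ)
    (hy : MemLp y 2 μ) (hu : MemLp u 2 μ)
    (hyt : Tendsto (fun n => eLpNorm (yn n - y) 2 μ) atTop (𝓝 0))
    (hut : Tendsto (fun n => eLpNorm (un n - u) 2 μ) atTop (𝓝 0)) :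
    Tendsto (fun n => ∫ τ, yn n τ (un n τ) ∂μ) atTop (𝓝 (∫ τ, y τ (u τ) ∂μ)) := by
  refine tendsto_integral_of_L1' _ (AntiDual.integrable_apply hy hu).1
    (Eventually.of_forall fun n => AntiDual.integrable_apply (hyn n) (hun n)) ?_
  have hlim : Tendsto (fun n => eLpNorm (yn n - y) 2 μ * eLpNorm (un n - u) 2 μ +
      eLpNorm (yn n - y) 2 μ * eLpNorm u 2 μ + eLpNorm y 2 μ * eLpNorm (un n - u) 2 μ)
      atTop (𝓝 0) := by
    have h1 := ENNReal.Tendsto.mul hyt (Or.inr ENNReal.zero_ne_top) hut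
      (Or.inr ENNReal.zero_ne_top)
    have h2 := ENNReal.Tendsto.mul_const hyt (Or.inr hu.2.ne)
    have h3 := ENNReal.Tendsto.const_mul hut (Or.inr hy.2.ne)
    simpa using (h1.add h2).add h3
  refine tendsto_of_tendsto_of_tendsto_of_le_of_le tendsto_const_nhds hlim
    (fun _ => zero_le) fun n => ?_
  have hdy := (hyn n).1.sub hy.1
  have hdu := (hun n).1.sub hu.1
  have hdec : (fun τ => yn n τ (un n τ)) - (fun τ => y τ (u τ)) =
      ((fun τ => (yn n - y) τ ((un n - u) τ)) + fun τ => (yn n - y) τ (u τ)) +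
        fun τ => y τ ((un n - u) τ) := by
    funext τ
    simp only [Pi.sub_apply, Pi.add_apply, sub_apply, map_sub]
    ring
  rw [hdec]
  refine (eLpNorm_add_le ((AntiDual.aestronglyMeasurable_apply hdy hdu).add
    (AntiDual.aestronglyMeasurable_apply hdy hu.1))
    (AntiDual.aestronglyMeasurable_apply hy.1 hdu) le_rfl).trans ?_
  refine add_le_add ((eLpNorm_add_le (AntiDual.aestronglyMeasurable_apply hdy hdu)
    (AntiDual.aestronglyMeasurable_apply hdy hu.1) le_rfl).trans (add_le_add ?_ ?_)) ?_
  · exact AntiDual.eLpNorm_apply_le hdy hdu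
  · exact AntiDual.eLpNorm_apply_le hdy hu.1
  · exact AntiDual.eLpNorm_apply_le hy.1 hdu

end Pairing

section Energy

variable {E U : Type*} [NormedAddCommGroup E] [InnerProductSpace ℂ E]
  [NormedAddCommGroup U] [InnerProductSpace ℂ U]

/-- `½ ‖x(t)‖² - ½ ‖x(0)‖² = Re ∫ ⟨ẋ, x⟩` for continuously differentiable `x`. -/
theorem half_norm_sq_sub_eq_integral {x : ℝ → E} {T : ℝ} (hT : 0 < T)
    (hx : ContDiffOn ℝ 1 x (Icc 0 T)) {t : ℝ} (ht : t ∈ Icc 0 T) :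
    1 / 2 * ‖x t‖ ^ 2 - 1 / 2 * ‖x 0‖ ^ 2 =
      (∫ τ in (0 : ℝ)..t, inner ℂ (x τ) (derivWithin x (Icc 0 T) τ)).re := by
  have hsub : Icc 0 t ⊆ Icc 0 T := Icc_subset_Icc_right ht.2
  have hxc : ContinuousOn x (Icc 0 T) := hx.continuousOn
  have hdc : ContinuousOn (derivWithin x (Icc 0 T)) (Icc 0 T) :=
    hx.continuousOn_derivWithin (uniqueDiffOn_Icc hT) le_rfl
  have hint : IntervalIntegrable (fun τ => inner ℂ (x τ) (derivWithin x (Icc 0 T) τ)) volume 0 t :=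
    ((hxc.inner hdc).mono hsub).intervalIntegrable_of_Icc ht.1
  have hint' : IntervalIntegrable (fun τ => (inner ℂ (x τ) (derivWithin x (Icc 0 T) τ)).re)
      volume 0 t :=
    ((Complex.continuous_re.comp_continuousOn (hxc.inner hdc)).mono hsub).intervalIntegrable_of_Icc
      ht.1
  have hnorm : ∀ z : E, ((inner ℂ z z : ℂ)).re = ‖z‖ ^ 2 := fun z =>
    inner_self_eq_norm_sq (𝕜 := ℂ) z
  have hre : (∫ τ in (0 : ℝ)..t, inner ℂ (x τ) (derivWithin x (Icc 0 T) τ)).re =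
      ∫ τ in (0 : ℝ)..t, (inner ℂ (x τ) (derivWithin x (Icc 0 T) τ)).re :=
    (Complex.reCLM.intervalIntegral_comp_comm hint).symm
  rw [hre, intervalIntegral.integral_eq_sub_of_hasDerivAt_of_le
    (f := fun τ => 1 / 2 * (inner ℂ (x τ) (x τ)).re) ht.1 ?_ ?_ hint']
  · simp only [hnorm]
  · exact continuousOn_const.mul
      (Complex.continuous_re.comp_continuousOn ((hxc.inner hxc).mono hsub))
  · intro τ hτ
    have hτT : τ ∈ Ioo 0 T := ⟨hτ.1, hτ.2.trans_le ht.2⟩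
    have hd : HasDerivAt x (derivWithin x (Icc 0 T) τ) τ :=
      (((hx.differentiableOn one_ne_zero) τ (Ioo_subset_Icc_self hτT)).hasDerivWithinAt).hasDerivAt
        (Icc_mem_nhds hτT.1 hτT.2)
    have h1 := (Complex.reCLM.hasFDerivAt.comp_hasDerivAt τ (hd.inner ℂ hd)).const_mul (1 / 2 : ℝ)
    refine h1.congr_deriv ?_
    rw [map_add, Complex.reCLM_apply, Complex.reCLM_apply, ← inner_conj_symm (x τ),
      Complex.conj_re]
    ring

variable {S : (E × U) →ₗ.[ℂ] (E × AntiDual U)} {M : (AntiDual E × U) →ₗ.[ℂ] (E × AntiDual U)}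
  {T : ℝ}

theorem IsRieszRealization.mem_graph_of_trajectory (hS : IsRieszRealization S M)
    {y : ℝ → AntiDual U} {x : ℝ → E} {u : ℝ → U} (h : IsClassicalTrajectory S T y x u) {τ : ℝ}
    (hτ : τ ∈ Icc 0 T) :
    ((rieszMap E (x τ), u τ), (derivWithin x (Icc 0 T) τ, -y τ)) ∈ M.graph :=
  (hS _ _ _ _).1 (h.equation τ hτ)

/-- The power balance `⟨M z, z⟩ = ⟨ẋ, x⟩ - ⟨y, u⟩` along classical trajectories. -/
theorem IsRieszRealization.powerOf_trajectory (hS : IsRieszRealization S M)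
    {y : ℝ → AntiDual U} {x : ℝ → E} {u : ℝ → U} (h : IsClassicalTrajectory S T y x u) {τ : ℝ}
    (hτ : τ ∈ Icc 0 T) : powerOf M (rieszMap E (x τ), u τ) =
      inner ℂ (x τ) (derivWithin x (Icc 0 T) τ) - y τ (u τ) := by
  rw [powerOf_eq_of_mem_graph (hS.mem_graph_of_trajectory h hτ), neg_apply, sub_eq_add_neg]

theorem ContinuousOn.memLp_restrict_Icc {V : Type*} [NormedAddCommGroup V] {v : ℝ → V} {a b : ℝ}
    (hv : ContinuousOn v (Icc a b)) (p : ENNReal) : MemLp v p (volume.restrict (Icc a b)) := by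
  obtain ⟨C, hC⟩ := isCompact_Icc.exists_bound_of_continuousOn hv
  exact MemLp.of_bound (hv.aestronglyMeasurable measurableSet_Icc) C
    (ae_restrict_of_forall_mem measurableSet_Icc hC)

variable [CompleteSpace E]

theorem IsRieszRealization.classical_energy_balance (hS : IsRieszRealization S M)
    (hM : IsDissipationNode M) (hT : 0 < T) {y : ℝ → AntiDual U} {x : ℝ → E} {u : ℝ → U}
    (h : IsClassicalTrajectory S T y x u) {t : ℝ} (ht : t ∈ Icc 0 T) :
    IntervalIntegrable (fun τ => powerOf M (rieszMap E (x τ), u τ)) volume 0 t ∧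
    IntervalIntegrable (fun τ => y τ (u τ)) volume 0 t ∧
    1 / 2 * ‖x t‖ ^ 2 - 1 / 2 * ‖x 0‖ ^ 2 =
      (∫ τ in (0 : ℝ)..t, powerOf M (rieszMap E (x τ), u τ)).re +
        (∫ τ in (0 : ℝ)..t, y τ (u τ)).re ∧
    1 / 2 * ‖x t‖ ^ 2 - 1 / 2 * ‖x 0‖ ^ 2 ≤ (∫ τ in (0 : ℝ)..t, y τ (u τ)).re := by
  have hsub : Icc 0 t ⊆ Icc 0 T := Icc_subset_Icc_right ht.2
  have hdc : ContinuousOn (derivWithin x (Icc 0 T)) (Icc 0 T) :=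
    h.x_contDiff.continuousOn_derivWithin (uniqueDiffOn_Icc hT) le_rfl
  have hyu : ContinuousOn (fun τ => y τ (u τ)) (Icc 0 T) :=
    continuous_antiDual_apply.comp_continuousOn (h.y_cont.prodMk h.u_cont)
  have hix : ContinuousOn (fun τ => inner ℂ (x τ) (derivWithin x (Icc 0 T) τ)) (Icc 0 T) :=
    h.x_contDiff.continuousOn.inner hdc
  have hp : ContinuousOn (fun τ => powerOf M (rieszMap E (x τ), u τ)) (Icc 0 T) :=
    (hix.sub hyu).congr fun τ hτ => hS.powerOf_trajectory h hτ
  have ip := (hp.mono hsub).intervalIntegrable_of_Icc (μ := volume) ht.1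
  have iy := (hyu.mono hsub).intervalIntegrable_of_Icc (μ := volume) ht.1
  have hbal : 1 / 2 * ‖x t‖ ^ 2 - 1 / 2 * ‖x 0‖ ^ 2 =
      (∫ τ in (0 : ℝ)..t, powerOf M (rieszMap E (x τ), u τ)).re +
        (∫ τ in (0 : ℝ)..t, y τ (u τ)).re := by
    rw [half_norm_sq_sub_eq_integral hT h.x_contDiff ht, ← Complex.add_re,
      ← intervalIntegral.integral_add ip iy]
    congr 1
    refine intervalIntegral.integral_congr fun τ hτ => ?_
    rw [uIcc_of_le ht.1] at hτ
    rw [hS.powerOf_trajectory h (hsub hτ), sub_add_cancel]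
  have hneg : (∫ τ in (0 : ℝ)..t, powerOf M (rieszMap E (x τ), u τ)).re ≤ 0 := by
    have hre := Complex.reCLM.intervalIntegral_comp_comm ip
    simp only [Complex.reCLM_apply] at hre
    rw [← hre, ← neg_nonneg, ← intervalIntegral.integral_neg]
    refine intervalIntegral.integral_nonneg ht.1 fun τ hτ => ?_
    have hg := hS.mem_graph_of_trajectory h (hsub hτ)
    rw [neg_nonneg, powerOf_eq_of_mem_graph hg]
    exact hM.re_le_of_mem_graph hg
  exact ⟨ip, iy, hbal, by linarith⟩

theorem IsRieszRealization.generalized_energy_balance (hS : IsRieszRealization S M)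
    (hM : IsDissipationNode M) (hT : 0 < T) {y : ℝ → AntiDual U} {x : ℝ → E} {u : ℝ → U}
    (h : IsGeneralizedTrajectory S T y x u) {t : ℝ} (ht : t ∈ Icc 0 T) :
    IntervalIntegrable (fun τ => y τ (u τ)) volume 0 t ∧
    (∀ (yn : ℕ → ℝ → AntiDual U) (xn : ℕ → ℝ → E) (un : ℕ → ℝ → U),
      (∀ n, IsClassicalTrajectory S T (yn n) (xn n) (un n)) →
      TrajectoryTendsto T yn xn un y x u →
      Tendsto (fun n => (∫ τ in (0 : ℝ)..t, powerOf M (rieszMap E (xn n τ), un n τ)).re) atTop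
        (𝓝 (1 / 2 * ‖x t‖ ^ 2 - 1 / 2 * ‖x 0‖ ^ 2 - (∫ τ in (0 : ℝ)..t, y τ (u τ)).re))) ∧
    1 / 2 * ‖x t‖ ^ 2 - 1 / 2 * ‖x 0‖ ^ 2 ≤ (∫ τ in (0 : ℝ)..t, y τ (u τ)).re := by
  have hle : (volume.restrict (Ioc 0 t) : Measure ℝ) ≤ volume.restrict (Icc 0 T) :=
    Measure.restrict_mono (Ioc_subset_Icc_self.trans (Icc_subset_Icc_right ht.2)) le_rfl
  have hyM := h.y_memLp.mono_measure hle
  have huM := h.u_memLp.mono_measure hle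
  have hconv : ∀ (yn : ℕ → ℝ → AntiDual U) (xn : ℕ → ℝ → E) (un : ℕ → ℝ → U),
      (∀ n, IsClassicalTrajectory S T (yn n) (xn n) (un n)) →
      TrajectoryTendsto T yn xn un y x u →
      Tendsto (fun n => (∫ τ in (0 : ℝ)..t, yn n τ (un n τ)).re) atTop
        (𝓝 (∫ τ in (0 : ℝ)..t, y τ (u τ)).re) ∧
      Tendsto (fun n => 1 / 2 * ‖xn n t‖ ^ 2 - 1 / 2 * ‖xn n 0‖ ^ 2) atTop
        (𝓝 (1 / 2 * ‖x t‖ ^ 2 - 1 / 2 * ‖x 0‖ ^ 2)) := by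
    intro yn xn un hn hlim
    refine ⟨(Complex.continuous_re.tendsto _).comp ?_, ?_⟩
    · simp only [intervalIntegral.integral_of_le ht.1]
      refine AntiDual.tendsto_integral_apply (fun n => ((hn n).y_cont.memLp_restrict_Icc 2).mono_measure hle)
        (fun n => ((hn n).u_cont.memLp_restrict_Icc 2).mono_measure hle) hyM huM ?_ ?_
      · exact tendsto_of_tendsto_of_tendsto_of_le_of_le tendsto_const_nhds hlim.y_tendsto
          (fun _ => zero_le) fun n => eLpNorm_mono_measure _ hle
      · exact tendsto_of_tendsto_of_tendsto_of_le_of_le tendsto_const_nhds hlim.u_tendsto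
          (fun _ => zero_le) fun n => eLpNorm_mono_measure _ hle
    · have h1 := hlim.x_tendsto.tendsto_at ht
      have h2 := hlim.x_tendsto.tendsto_at (left_mem_Icc.2 hT.le)
      exact ((h1.norm.pow 2).const_mul _).sub ((h2.norm.pow 2).const_mul _)
  refine ⟨(intervalIntegrable_iff_integrableOn_Ioc_of_le ht.1).2
    (AntiDual.integrable_apply hyM huM), ?_, ?_⟩
  · intro yn xn un hn hlim
    obtain ⟨h1, h2⟩ := hconv yn xn un hn hlim
    refine (h2.sub h1).congr fun n => ?_
    rw [(hS.classical_energy_balance hM hT (hn n) ht).2.2.1, add_sub_cancel_right]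
  · obtain ⟨yn, xn, un, hn, hlim⟩ := h.approx
    obtain ⟨h1, h2⟩ := hconv yn xn un hn hlim
    exact le_of_tendsto_of_tendsto' h2 h1 fun n =>
      (hS.classical_energy_balance hM hT (hn n) ht).2.2.2

end Energy

end

theorem mainTheorem1 {X U : Type*}
    [NormedAddCommGroup X] [InnerProductSpace ℂ X] [CompleteSpace X]
    [NormedAddCommGroup U] [InnerProductSpace ℂ U] [CompleteSpace U]
    (h : ClosedPositiveForm X)
    (M : (AntiDual h.EnergeticSpace × U) →ₗ.[ℂ] (h.EnergeticSpace × AntiDual U))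
    (hM : IsDissipationNode M)
    (S : (h.EnergeticSpace × U) →ₗ.[ℂ] (h.EnergeticSpace × AntiDual U))
    (hS : S = portHamiltonianNode h M) :
    -- (a) `S` is a system node
    IsSystemNode S ∧
    -- (b) the main operator is `F Ht` and generates a contractive semigroup
    (mainOperator S = precompPMap (mainOperator M) h.energeticExtension.toLinearMap ∧
      GeneratesContractionSemigroup (mainOperator S)) ∧
    -- (c) the transfer function is (well) defined on the right half-plane and positive there
    ((∀ s : ℂ, 0 < s.re → s ∈ resolventSetOf (mainOperator S)) ∧
      (∃! G : resolventSetOf (mainOperator S) → U →L[ℂ] AntiDual U, IsTransferFunction S G) ∧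
      ∀ G : resolventSetOf (mainOperator S) → U →L[ℂ] AntiDual U, IsTransferFunction S G →
        ∀ s : resolventSetOf (mainOperator S), 0 < (s : ℂ).re →
          ∀ u : U, 0 ≤ (G s u u).re) ∧
    -- (d) energy balance and dissipation inequality
    ∀ T : ℝ, 0 < T →
      -- classical trajectories
      (∀ (y : ℝ → AntiDual U) (x : ℝ → h.EnergeticSpace) (u : ℝ → U),
        IsClassicalTrajectory S T y x u →
        (∀ t ∈ Set.Icc 0 T, (h.energeticExtension (x t), u t) ∈ M.domain) ∧
        ∀ t ∈ Set.Icc 0 T,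
          IntervalIntegrable (fun τ => powerOf M (h.energeticExtension (x τ), u τ))
            MeasureTheory.volume 0 t ∧
          IntervalIntegrable (fun τ => y τ (u τ)) MeasureTheory.volume 0 t ∧
          h.hamiltonian (x t) - h.hamiltonian (x 0) =
            (∫ τ in (0 : ℝ)..t, powerOf M (h.energeticExtension (x τ), u τ)).re +
              (∫ τ in (0 : ℝ)..t, y τ (u τ)).re ∧
          h.hamiltonian (x t) - h.hamiltonian (x 0) ≤ (∫ τ in (0 : ℝ)..t, y τ (u τ)).re) ∧
      -- generalized trajectories: the inequality, and the balance with the dissipated energy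
      -- understood as the limit along classical trajectories
      (∀ (y : ℝ → AntiDual U) (x : ℝ → h.EnergeticSpace) (u : ℝ → U),
        IsGeneralizedTrajectory S T y x u →
        ∀ t ∈ Set.Icc 0 T,
          IntervalIntegrable (fun τ => y τ (u τ)) MeasureTheory.volume 0 t ∧
          (∀ (yn : ℕ → ℝ → AntiDual U) (xn : ℕ → ℝ → h.EnergeticSpace) (un : ℕ → ℝ → U),
            (∀ n, IsClassicalTrajectory S T (yn n) (xn n) (un n)) →
            TrajectoryTendsto T yn xn un y x u →
            Filter.Tendsto
              (fun n => (∫ τ in (0 : ℝ)..t,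
                powerOf M (h.energeticExtension (xn n τ), un n τ)).re)
              Filter.atTop
              (nhds (h.hamiltonian (x t) - h.hamiltonian (x 0) -
                (∫ τ in (0 : ℝ)..t, y τ (u τ)).re))) ∧
          h.hamiltonian (x t) - h.hamiltonian (x 0) ≤ (∫ τ in (0 : ℝ)..t, y τ (u τ)).re) := by
  subst hS
  have hS := isRieszRealization_portHamiltonianNode h M
  rw [h.energeticExtension_eq_rieszMap]
  refine ⟨hS.isSystemNode hM, ⟨hS.mainOperator_eq, hS.generatesContractionSemigroup hM⟩,
    ⟨hS.mem_resolventSet hM, (hS.isSystemNode hM).toIsOperatorNode.existsUnique_transferFunction,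
      fun G hG s hs u => hS.re_transferFunction_nonneg hM hG s hs u⟩, fun T hT => ⟨?_, ?_⟩⟩
  · intro y x u hyxu
    exact ⟨fun t ht => LinearPMap.mem_domain_of_mem_graph (hS.mem_graph_of_trajectory hyxu ht),
      fun t ht => hS.classical_energy_balance hM hT hyxu ht⟩
  · intro y x u hyxu t ht
    exact hS.generalized_energy_balance hM hT hyxu ht
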